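/- All groups are profinite, subgroups are closed and homomorphisms are continuous. Let $G$ be a profinite group. A \emph{cover} of $G$ is an epimorphism $\eta\colon E\twoheadrightarrow G$; two covers are isomorphic over $G$ ($\cong_G$) if there is an isomorphism of profinite groups between their sources compatible with the maps to $G$. A cover $\eta$ is \emph{indecomposable} if it is not an isomorphism and, whenever $\eta=\rho\circ\psi$ with epimorphisms $\psi,\rho$, one of $\psi,\rho$ is an isomorphism. The fiber product of a family of covers $(\eta_i\colon H_i\twoheadrightarrow G)_{i\in I}$ is written $\prod_{G,\,i\in I}H_i$; for $I=\emptyset$ it is $G$ with the identity map. For an epimorphism $\pi\colon H\twoheadrightarrow G$ let $\mathcal M(\pi)$ be the intersection, taken inside $\operatorname{Ker}\pi$, of all maximal elements among the normal subgroups of $H$ strictly contained in $\operatorname{Ker}\pi$. Call $\pi$ \emph{fundamental} if $\mathcal M(\pi)=1$. Let $\Lambda_{\mathrm{na}}(G)$ be a set of representatives of the isomorphism classes of indecomposable covers of $G$ with non-abelian kernel, let $\Lambda_{\mathrm{ab}}(G)$ be a set of representatives of the isomorphism classes of finite simple $G$-modules, and let $\Lambda(G)=\Lambda_{\mathrm{na}}(G)\sqcup\Lambda_{\mathrm{ab}}(G)$.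 For $\zeta\in\Lambda_{\mathrm{na}}(G)$ let $\mathcal C_\zeta$ be the set of normal subgroups $N\le\operatorname{Ker}\pi$ of $H$ with $(H/N\twoheadrightarrow G)\cong_G\zeta$. For $A\in\Lambda_{\mathrm{ab}}(G)$ let $\mathcal C_A$ be the set of normal subgroups $N\le\operatorname{Ker}\pi$ of $H$ with $\operatorname{Ker}(H/N\twoheadrightarrow G)\cong A$ as $G$-modules. For $\lambda\in\Lambda(G)$ let $H_\lambda=H/N_\lambda$, where $N_\lambda=\bigcap_{N\in\mathcal C_\lambda}N$ (and $N_\lambda=\operatorname{Ker}\pi$ if $\mathcal C_\lambda=\emptyset$). For $A\in\Lambda_{\mathrm{ab}}(G)$ let $F_A=\operatorname{End}_G(A)$ (a finite field), let $B_A=\operatorname{Ker}(H_A\twoheadrightarrow G)$, a $G$-module by conjugation, let $f_A\in H^2(G,B_A)$ be the class of the extension $1\to B_A\to H_A\to G\to 1$, let $B_A^*=\operatorname{Hom}_G(B_A,A)$ (continuous homomorphisms), a vector space over $F_A$, and let $S_A\colon B_A^*\to H^2(G,A)$ be the $F_A$-linear map $\varphi\mapsto\varphi_*f_A$ (continuous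 cohomology). \textbf{Theorem.} Let $\pi\colon H\twoheadrightarrow G$ be fundamental. Then $$H\;\cong_G\;\prod_{G,\,\lambda\in\Lambda(G)}H_\lambda\;=\;\Big(\prod_{G,\,\zeta\in\Lambda_{\mathrm{na}}(G)}H_\zeta\Big)\times_G\Big(\prod_{G,\,A\in\Lambda_{\mathrm{ab}}(G)}H_A\Big).$$ Moreover: (a) For every $\zeta\in\Lambda_{\mathrm{na}}(G)$, $H_\zeta\cong_G\prod_{G,\,i\in I_\zeta}H_i$, where $|I_\zeta|=|\mathcal C_\zeta|$ and $\eta_i\colon H_i\twoheadrightarrow G$ is isomorphic to $\zeta$ for every $i\in I_\zeta$. (b) For every $A\in\Lambda_{\mathrm{ab}}(G)$ and every basis $(\varphi_i)_{i\in I_A}$ of $B_A^*$ over $F_A$, there are extensions $\eta_i\colon H_i\twoheadrightarrow G$ of $G$ by $A$ with class $S_A(\varphi_i)\in H^2(G,A)$, and, for any such $\eta_i$, $H_A\cong_G\prod_{G,\,i\in I_A}H_i$. Thus $H$ is isomorphic over $G$ to the fiber product of the family $(\eta_i\colon H_i\twoheadrightarrow G)_{i\in I}$ of indecomposable covers of $G$,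 where $I=\bigsqcup_{\zeta\in\Lambda_{\mathrm{na}}(G)}I_\zeta\sqcup\bigsqcup_{A\in\Lambda_{\mathrm{ab}}(G)}I_A$. Conversely, the fiber product of every family of indecomposable covers of $G$ is fundamental over $G$. Hence an epimorphism $\pi\colon H\twoheadrightarrow G$ is fundamental if and only if it is isomorphic over $G$ to the structure map of a fiber product of indecomposable covers of $G$. -/

import Mathlib

universe u v w

/-! ### Covers of a profinite group -/

/-- A cover (extension) of the profinite group `G`: a profinite group `total` together with a
continuous surjective homomorphism `map : total → G`. -/
structure GroupCover (G : ProfiniteGrp.{u}) : Type (max u (v + 1)) where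
  total : ProfiniteGrp.{v}
  map : total →ₜ* G
  surj : Function.Surjective map

namespace GroupCover

variable {G : ProfiniteGrp.{u}}

/-- The kernel of a cover. -/
def ker (π : GroupCover.{u, v} G) : Subgroup π.total :=
  MonoidHom.ker (π.map : π.total →* G)

theorem mem_ker (π : GroupCover.{u, v} G) {h : π.total} : h ∈ π.ker ↔ π.map h = 1 :=
  Iff.rfl

/-- Two covers of `G` are isomorphic over `G`. -/
def IsoOver (π : GroupCover.{u, v} G) (η : GroupCover.{u, w} G) : Prop :=
  ∃ e : π.total ≃ₜ* η.total, ∀ h, η.map (e h) = π.map h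

/-- A cover is indecomposable if it is not an isomorphism, and in every factorization through
epimorphisms of profinite groups one of the two factors is an isomorphism. (A continuous
homomorphism of profinite groups is an isomorphism if and only if it is bijective.) -/
def IsIndecomposable (π : GroupCover.{u, v} G) : Prop :=
  ¬ Function.Bijective π.map ∧
    ∀ (ρ : GroupCover.{u, v} G) (ψ : π.total →ₜ* ρ.total), Function.Surjective ψ →
      (∀ h, ρ.map (ψ h) = π.map h) → Function.Bijective ψ ∨ Function.Bijective ρ.map

/-- The kernel of the cover is abelian. -/
def HasAbelianKer (π : GroupCover.{u, v} G) : Prop :=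
  ∀ x ∈ π.ker, ∀ y ∈ π.ker, x * y = y * x

/-- `N` is a closed normal subgroup of the total group, contained in the kernel of `π`. -/
structure IsSubKernel (π : GroupCover.{u, v} G) (N : Subgroup π.total) : Prop where
  normal : N.Normal
  closed : IsClosed (N : Set π.total)
  le : N ≤ π.ker

/-- The closed normal subgroups of `H` that are maximal among those strictly contained in `M`. -/
def maxNormalBelow (H : ProfiniteGrp.{v}) (M : Subgroup H) : Set (Subgroup H) :=
  {N | Maximal (fun L : Subgroup H => L.Normal ∧ IsClosed (L : Set H) ∧ L < M) N}

/-- The fundament kernel of `π`: the intersection, inside `Ker π`, of all the maximal ones among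
the closed normal subgroups strictly contained in `Ker π` (it is `Ker π` if there are none). -/
def fundamentKer (π : GroupCover.{u, v} G) : Subgroup π.total :=
  π.ker ⊓ sInf (maxNormalBelow π.total π.ker)

/-- A cover is fundamental if its fundament kernel is trivial. -/
def IsFundamental (π : GroupCover.{u, v} G) : Prop :=
  π.fundamentKer = ⊥

/-! ### Quotient covers -/

theorem totallyDisconnectedSpace_quotient (H : ProfiniteGrp.{v}) (N : Subgroup H)
    (hc : IsClosed (N : Set H)) : TotallyDisconnectedSpace (H ⧸ N) := by
  suffices TotallySeparatedSpace (H ⧸ N) from inferInstance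
  rw [totallySeparatedSpace_iff_exists_isClopen]
  intro p q hpq
  induction p using QuotientGroup.induction_on with | _ a
  induction q using QuotientGroup.induction_on with | _ b
  have hab : a⁻¹ * b ∉ N := fun h => hpq (QuotientGroup.eq.2 h)
  obtain ⟨V, hNV, hV⟩ : ∃ V : OpenSubgroup H, N ≤ (V : Subgroup H) ∧ a⁻¹ * b ∉ V := by
    by_contra! hcon
    apply hab
    have h := ProfiniteGrp.closedSubgroup_eq_sInf_open (⟨N, hc⟩ : ClosedSubgroup H)
    have h2 : a⁻¹ * b ∈ ((⟨N, hc⟩ : ClosedSubgroup H) : Subgroup H) := by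
      rw [h, Subgroup.mem_sInf]
      intro L hL
      exact hcon ⟨L, hL.1⟩ hL.2
    exact h2
  have hpre : (QuotientGroup.mk : H → H ⧸ N) ⁻¹' (QuotientGroup.mk '' {h : H | a⁻¹ * h ∈ V}) =
      {h : H | a⁻¹ * h ∈ V} := by
    ext h
    constructor
    · rintro ⟨k, hk, hkh⟩
      have h1 : k⁻¹ * h ∈ V := hNV (QuotientGroup.eq.1 hkh)
      have h2 := V.mul_mem hk h1
      simpa [mul_assoc] using h2
    · intro hh
      exact ⟨h, hh, rfl⟩
  refine ⟨QuotientGroup.mk '' {h : H | a⁻¹ * h ∈ V}, ?_, ⟨a, by simp, rfl⟩, ?_⟩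
  · have hq : Topology.IsQuotientMap (QuotientGroup.mk : H → H ⧸ N) :=
      QuotientGroup.isQuotientMap_mk N
    rw [← hq.isClopen_preimage, hpre]
    exact V.isClopen.preimage (continuous_const_mul a⁻¹)
  · intro hb
    have : b ∈ (QuotientGroup.mk : H → H ⧸ N) ⁻¹' (QuotientGroup.mk '' {h : H | a⁻¹ * h ∈ V}) := hb
    rw [hpre] at this
    exact hV this

/-- The cover `H ⧸ N → G` induced by `π : H → G`, for a closed normal subgroup `N` of `H`
contained in `Ker π`. -/
noncomputable def quot (π : GroupCover.{u, v} G) (N : Subgroup π.total) (hN : π.IsSubKernel N) :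
    GroupCover.{u, v} G :=
  haveI := hN.normal
  haveI := totallyDisconnectedSpace_quotient π.total N hN.closed
  { total := ProfiniteGrp.of (π.total ⧸ N)
    map :=
      { toMonoidHom := QuotientGroup.lift N (π.map : π.total →* G) hN.le
        continuous_toFun := continuous_quot_lift _ π.map.continuous_toFun }
    surj := fun g => by
      obtain ⟨h, rfl⟩ := π.surj g
      exact ⟨(h : π.total ⧸ N), rfl⟩ }

/-- The intersection, inside `Ker π`, of a set of closed normal subgroups contained in `Ker π`
(it is `Ker π` if the set is empty). -/
theorem isSubKernel_inter (π : GroupCover.{u, v} G) (C : Set (Subgroup π.total))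
    (hC : ∀ N ∈ C, π.IsSubKernel N) : π.IsSubKernel (π.ker ⊓ sInf C) where
  normal := by
    refine ⟨fun n hn g => ?_⟩
    rw [Subgroup.mem_inf, Subgroup.mem_sInf] at hn ⊢
    exact ⟨(MonoidHom.normal_ker (π.map : π.total →* G)).conj_mem n hn.1 g,
      fun N hN => (hC N hN).normal.conj_mem n (hn.2 N hN) g⟩
  closed := by
    rw [Subgroup.coe_inf, Subgroup.coe_sInf]
    refine IsClosed.inter ?_ (isClosed_biInter fun N hN => (hC N hN).closed)
    exact isClosed_singleton.preimage π.map.continuous_toFun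
  le := inf_le_left

/-! ### Fiber products -/

/-- The underlying group of the fiber product of a family of covers of `G`: the families
`(h_i)` whose members have a common image `g` in `G`. Recording `g` makes the definition also
correct for the empty family, whose fiber product is `G`. -/
def fiberSubgroup {I : Type w} (E : I → GroupCover.{u, v} G) :
    Subgroup (G × ((i : I) → (E i).total)) where
  carrier := {p | ∀ i, (E i).map (p.2 i) = p.1}
  mul_mem' := fun {a b} ha hb i => by
    change (E i).map (a.2 i * b.2 i) = a.1 * b.1
    rw [map_mul, ha i, hb i]
  one_mem' := fun i => map_one (E i).map
  inv_mem' := fun {a} ha i => by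
    change (E i).map (a.2 i)⁻¹ = a.1⁻¹
    rw [map_inv, ha i]

theorem isClosed_fiberSubgroup {I : Type w} (E : I → GroupCover.{u, v} G) :
    IsClosed (fiberSubgroup E : Set (G × ((i : I) → (E i).total))) := by
  have h : (fiberSubgroup E : Set (G × ((i : I) → (E i).total))) =
      ⋂ i, {p | (E i).map (p.2 i) = p.1} := by
    ext p
    simp [fiberSubgroup]
  rw [h]
  refine isClosed_iInter fun i => isClosed_eq ?_ continuous_fst
  exact (E i).map.continuous_toFun.comp ((continuous_apply i).comp continuous_snd)

/-- The fiber product of a family of covers of `G`, with its structure map to `G`. -/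
noncomputable def fiberProduct {I : Type w} (E : I → GroupCover.{u, v} G) :
    GroupCover.{u, max u v w} G :=
  haveI : CompactSpace (fiberSubgroup E) :=
    isCompact_iff_compactSpace.mp (isClosed_fiberSubgroup E).isCompact
  { total := ProfiniteGrp.of (fiberSubgroup E)
    map :=
      { toMonoidHom := (MonoidHom.fst G ((i : I) → (E i).total)).comp (fiberSubgroup E).subtype
        continuous_toFun := continuous_fst.comp continuous_subtype_val }
    surj := fun g => by
      choose h hh using fun i => (E i).surj g
      exact ⟨⟨(g, h), hh⟩, rfl⟩ }

/-! ### Continuous sections -/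

/-- `s` is a continuous section of the cover `π`. -/
def IsSection (π : GroupCover.{u, v} G) (s : G → π.total) : Prop :=
  Continuous s ∧ ∀ g, π.map (s g) = g

/-- A closed set of `H` that maps onto `G`, and is a union of cosets of a subgroup such that the
elements with the same image in `G` lie in the same coset. -/
def IsPartialTransversal (π : GroupCover.{u, v} G) (T : Set π.total) : Prop :=
  IsClosed T ∧ (∀ g, ∃ x ∈ T, π.map x = g) ∧
    ∀ x ∈ T, ∀ y ∈ T, ∀ z ∈ T, π.map x = π.map y → z * x⁻¹ * y ∈ T

open Classical in
theorem IsPartialTransversal.shrink (π : GroupCover.{u, v} G) (T : Set π.total)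
    (hT : π.IsPartialTransversal T) (x₀ y₀ : π.total) (hne : x₀ ≠ y₀) :
    ∃ T' ⊆ T, π.IsPartialTransversal T' ∧
      (π.map x₀ = π.map y₀ → ¬ (x₀ ∈ T' ∧ y₀ ∈ T')) := by
  obtain ⟨hcl, hsur, hheap⟩ := hT
  obtain ⟨U, hU⟩ := ProfiniteGrp.exist_openNormalSubgroup_sub_open_nhds_of_one (G := π.total)
    (U := {x₀⁻¹ * y₀}ᶜ) isClosed_singleton.isOpen_compl (by
      intro h
      exact hne (inv_mul_eq_one.1 (Set.mem_singleton_iff.1 h).symm))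
  have hU' : x₀⁻¹ * y₀ ∉ (U : Subgroup π.total) := fun h => hU h rfl
  let Q := π.total ⧸ (U : Subgroup π.total)
  have hfin : Finite Q := inferInstanceAs (Finite (π.total ⧸ U.toOpenSubgroup.toSubgroup))
  have hdisc : DiscreteTopology Q :=
    inferInstanceAs (DiscreteTopology (π.total ⧸ U.toOpenSubgroup.toSubgroup))
  let q : π.total → Q := QuotientGroup.mk
  have hq : Continuous q := continuous_quotient_mk'
  have hqmul : ∀ a b, q (a * b) = q a * q b := fun _ _ => rfl
  have hqinv : ∀ a, q a⁻¹ = (q a)⁻¹ := fun _ => rfl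
  let S : G → Set Q := fun g => {c | ∃ x ∈ T, π.map x = g ∧ q x = c}
  have hclosed_img : ∀ K : Set π.total, IsClosed K → IsClosed (π.map '' K) := fun K hK =>
    (hK.isCompact.image π.map.continuous_toFun).isClosed
  have hSclosed : ∀ c, IsClosed {g | c ∈ S g} := by
    intro c
    have : {g | c ∈ S g} = π.map '' (T ∩ q ⁻¹' {c}) := by
      ext g
      constructor
      · rintro ⟨x, hx, hg, hc⟩
        exact ⟨x, ⟨hx, hc⟩, hg⟩
      · rintro ⟨x, ⟨hx, hc⟩, hg⟩
        exact ⟨x, hx, hg, hc⟩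
    rw [this]
    exact hclosed_img _ (hcl.inter ((isClosed_discrete _).preimage hq))
  have hSopen : ∀ c, IsClosed {g | c ∉ S g} := by
    intro c
    have : {g | c ∉ S g} =
        π.map '' (T ∩ q ⁻¹' {d | ∃ x ∈ T, q x = d ∧ c ∉ S (π.map x)}) := by
      ext g
      constructor
      · intro hg
        obtain ⟨x, hx, rfl⟩ := hsur g
        exact ⟨x, ⟨hx, x, hx, rfl, hg⟩, rfl⟩
      · rintro ⟨x, ⟨hx, x', hx', hxx', hc⟩, rfl⟩ ⟨t, ht, htx, htc⟩
        refine hc ⟨x' * x⁻¹ * t, hheap x hx t ht x' hx' htx.symm, ?_, ?_⟩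
        · rw [map_mul, map_mul, map_inv, htx, inv_mul_cancel_right]
        · rw [hqmul, hqmul, hqinv, hxx', htc, mul_inv_cancel, one_mul]
    rw [this]
    exact hclosed_img _ (hcl.inter ((isClosed_discrete _).preimage hq))
  let κ : Set Q → Q := fun s => if h : s.Nonempty then h.choose else 1
  have hκ : ∀ g, κ (S g) ∈ S g := by
    intro g
    have h : (S g).Nonempty := by
      obtain ⟨x, hx, hxg⟩ := hsur g
      exact ⟨q x, x, hx, hxg, rfl⟩
    simp only [κ, dif_pos h]
    exact h.choose_spec
  have hSloc : IsLocallyConstant S := by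
    rw [IsLocallyConstant.iff_exists_open]
    intro g
    refine ⟨⋂ c : Q, {g' | c ∈ S g' ↔ c ∈ S g}, isOpen_iInter_of_finite fun c => ?_, ?_, ?_⟩
    · by_cases hc : c ∈ S g
      · simp only [hc, iff_true]
        rw [← isClosed_compl_iff]
        exact hSopen c
      · simp only [hc, iff_false]
        rw [← isClosed_compl_iff]
        simpa [Set.compl_def] using hSclosed c
    · simp
    · intro g' hg'
      ext c
      exact Set.mem_iInter.1 hg' c
  have hκcont : Continuous fun x : π.total => κ (S (π.map x)) :=
    ((hSloc.comp κ).continuous).comp π.map.continuous_toFun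
  refine ⟨{x | x ∈ T ∧ q x = κ (S (π.map x))}, fun x hx => hx.1, ⟨?_, ?_, ?_⟩, ?_⟩
  · exact hcl.inter (isClosed_eq hq hκcont)
  · intro g
    obtain ⟨x, hx, hxg, hxq⟩ := hκ g
    exact ⟨x, ⟨hx, by rw [hxg, hxq]⟩, hxg⟩
  · rintro x ⟨hx, hxq⟩ y ⟨hy, hyq⟩ z ⟨hz, hzq⟩ hxy
    refine ⟨hheap x hx y hy z hz hxy, ?_⟩
    have h1 : π.map (z * x⁻¹ * y) = π.map z := by
      rw [map_mul, map_mul, map_inv, hxy, inv_mul_cancel_right]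
    rw [h1, ← hzq, hqmul, hqmul, hqinv, hxq, hyq, hxy, inv_mul_cancel_right]
  · rintro hxy ⟨⟨-, hx⟩, -, hy⟩
    apply hU'
    rw [← QuotientGroup.eq]
    change q x₀ = q y₀
    rw [hx, hy, hxy]

theorem exists_section (π : GroupCover.{u, v} G) : ∃ s, π.IsSection s := by
  obtain ⟨T, -, hT, hmin⟩ := zorn_superset_nonempty {T | π.IsPartialTransversal T} (by
    intro c hc hchain hne
    refine ⟨⋂₀ c, ⟨isClosed_sInter fun T hT => (hc hT).1, ?_, ?_⟩,
      fun T hT => Set.sInter_subset_of_mem hT⟩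
    · intro g
      have : Nonempty c := hne.to_subtype
      have hfib : IsClosed (π.map ⁻¹' {g}) := isClosed_singleton.preimage π.map.continuous_toFun
      have hcl : ∀ T : c, IsClosed ((T : Set π.total) ∩ π.map ⁻¹' {g}) :=
        fun T => (hc T.2).1.inter hfib
      obtain ⟨x, hx⟩ := IsCompact.nonempty_iInter_of_directed_nonempty_isCompact_isClosed
        (fun T : c => (T : Set π.total) ∩ π.map ⁻¹' {g})
        (by
          intro T T'
          rcases hchain.total T.2 T'.2 with h | h
          · exact ⟨T, subset_rfl, Set.inter_subset_inter_left _ h⟩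
          · exact ⟨T', Set.inter_subset_inter_left _ h, subset_rfl⟩)
        (fun T => by
          obtain ⟨x, hx, hxg⟩ := (hc T.2).2.1 g
          exact ⟨x, hx, hxg⟩)
        (fun T => (hcl T).isCompact) hcl
      rw [Set.mem_iInter] at hx
      exact ⟨x, fun T hT => (hx ⟨T, hT⟩).1, (hx (Classical.arbitrary c)).2⟩
    · intro x hx y hy z hz hxy T hT
      exact (hc hT).2.2 x (hx T hT) y (hy T hT) z (hz T hT) hxy)
    Set.univ ⟨isClosed_univ, fun g => (π.surj g).imp fun x hx => ⟨trivial, hx⟩,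
      fun _ _ _ _ _ _ _ => trivial⟩
  have hinj : ∀ x ∈ T, ∀ y ∈ T, π.map x = π.map y → x = y := by
    intro x hx y hy hxy
    by_contra hne
    obtain ⟨T', hT'T, hT', hnot⟩ := IsPartialTransversal.shrink π T hT x y hne
    have hle := hmin hT' hT'T
    exact hnot hxy ⟨hle hx, hle hy⟩
  choose s hsT hs using hT.2.1
  refine ⟨s, ?_, hs⟩
  rw [continuous_iff_isClosed]
  intro K hK
  have : s ⁻¹' K = π.map '' (T ∩ K) := by
    ext g
    constructor
    · intro hg
      exact ⟨s g, ⟨hsT g, hg⟩, hs g⟩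
    · rintro ⟨x, ⟨hx, hxK⟩, rfl⟩
      have : s (π.map x) = x := hinj _ (hsT _) _ hx (hs _)
      change s (π.map x) ∈ K
      rwa [this]
  rw [this]
  exact ((hT.1.inter hK).isCompact.image π.map.continuous_toFun).isClosed

end GroupCover

/-! ### Finite simple modules, cohomology -/

/-- A finite simple `G`-module: a nonzero finite abelian group with the discrete topology and a
continuous action of `G`, without nontrivial proper submodules. -/
structure FiniteSimpleModule (G : ProfiniteGrp.{u}) : Type (u + 1) where
  carrier : Type u
  [addCommGroup : AddCommGroup carrier]
  [finite : Finite carrier]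
  [topologicalSpace : TopologicalSpace carrier]
  [discreteTopology : DiscreteTopology carrier]
  [distribMulAction : DistribMulAction G carrier]
  [continuousSMul : ContinuousSMul G carrier]
  [nontrivial : Nontrivial carrier]
  simple : ∀ B : AddSubgroup carrier, (∀ (g : G), ∀ b ∈ B, g • b ∈ B) → B = ⊥ ∨ B = ⊤

namespace FiniteSimpleModule

variable {G : ProfiniteGrp.{u}}

instance : CoeSort (FiniteSimpleModule G) (Type u) := ⟨carrier⟩

attribute [instance] addCommGroup finite topologicalSpace discreteTopology distribMulAction
  continuousSMul nontrivial

/-- The ring `F_A = End_G(A)`. -/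
def endRing (A : FiniteSimpleModule G) : Subring (AddMonoid.End A) where
  carrier := {f | ∀ (g : G) (a : A), f (g • a) = g • f a}
  mul_mem' := fun {f f'} hf hf' g a => by
    change f (f' (g • a)) = g • f (f' a)
    rw [hf', hf]
  one_mem' := fun _ _ => rfl
  add_mem' := fun {f f'} hf hf' g a => by
    change f (g • a) + f' (g • a) = g • (f a + f' a)
    rw [hf, hf', smul_add]
  zero_mem' := fun g _ => (smul_zero g).symm
  neg_mem' := fun {f} hf g a => by
    change -f (g • a) = g • (-f a)
    rw [hf, smul_neg]

theorem endRing_smul_def (A : FiniteSimpleModule G) (c : A.endRing) (a : A) :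
    c • a = (c : AddMonoid.End A) a := rfl

theorem endRing_smul_smul (A : FiniteSimpleModule G) (c : A.endRing) (g : G) (a : A) :
    c • (g • a) = g • (c • a) := c.2 g a

/-- `F_A` is a field, so that modules over it are vector spaces. -/
theorem isField_endRing (A : FiniteSimpleModule G) : IsField A.endRing := by
  have : Finite A.endRing := Finite.of_injective
    (fun (f : A.endRing) (a : A) => (f : AddMonoid.End A) a)
    fun f f' h => Subtype.ext (AddMonoidHom.ext fun a => congrFun h a)
  have : Nontrivial A.endRing := by
    obtain ⟨a, ha⟩ := exists_ne (0 : A)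
    refine ⟨0, 1, fun h => ha ?_⟩
    exact (congrArg (fun f : A.endRing => (f : AddMonoid.End A) a) h).symm
  have : NoZeroDivisors A.endRing := by
    refine ⟨fun {f f'} h => ?_⟩
    have hff : ∀ a, (f : AddMonoid.End A) ((f' : AddMonoid.End A) a) = 0 := fun a =>
      congrArg (fun f : A.endRing => (f : AddMonoid.End A) a) h
    rcases A.simple (AddMonoidHom.range (f' : AddMonoid.End A)) (by
      rintro g _ ⟨a, rfl⟩
      exact ⟨g • a, f'.2 g a⟩) with hr | hr
    · right
      refine Subtype.ext (AddMonoidHom.ext fun a => ?_)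
      have : (f' : AddMonoid.End A) a ∈ AddMonoidHom.range (f' : AddMonoid.End A) := ⟨a, rfl⟩
      rw [hr] at this
      exact this
    · left
      refine Subtype.ext (AddMonoidHom.ext fun a => ?_)
      have : a ∈ AddMonoidHom.range (f' : AddMonoid.End A) := by
        rw [hr]
        trivial
      obtain ⟨b, rfl⟩ := this
      exact hff b
  have : IsDomain A.endRing := NoZeroDivisors.to_isDomain _
  exact Finite.isDomain_to_isField _

/-- Continuous inhomogeneous 2-cocycles of `G` with values in `A`. -/
def cocycles₂ (A : FiniteSimpleModule G) : Submodule A.endRing (G × G → A) where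
  carrier := {f | Continuous f ∧
    ∀ a b c : G, a • f (b, c) - f (a * b, c) + f (a, b * c) - f (a, b) = 0}
  add_mem' := fun {f f'} hf hf' => by
    refine ⟨hf.1.add hf'.1, fun a b c => ?_⟩
    have h := congrArg₂ (· + ·) (hf.2 a b c) (hf'.2 a b c)
    simp only [Pi.add_apply, smul_add]
    simp only [add_zero] at h
    rw [← h]
    abel
  zero_mem' := ⟨continuous_const, fun a b c => by simp⟩
  smul_mem' := fun r f hf => by
    refine ⟨continuous_of_discreteTopology.comp hf.1 (g := fun a : A => r • a), fun a b c => ?_⟩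
    have h := congrArg (fun z : A => r • z) (hf.2 a b c)
    simp only [smul_add, smul_sub, smul_zero, endRing_smul_smul] at h
    exact h

/-- Coboundaries of continuous inhomogeneous 1-cochains of `G` with values in `A`. -/
def coboundaries₂ (A : FiniteSimpleModule G) : Submodule A.endRing (G × G → A) where
  carrier := {f | ∃ k : G → A, Continuous k ∧ ∀ a b : G, f (a, b) = a • k b - k (a * b) + k a}
  add_mem' := by
    rintro f f' ⟨k, hk, hf⟩ ⟨k', hk', hf'⟩
    refine ⟨fun a => k a + k' a, hk.add hk', fun a b => ?_⟩
    simp only [Pi.add_apply, hf, hf', smul_add]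
    abel
  zero_mem' := ⟨fun _ => 0, continuous_const, fun a b => by simp⟩
  smul_mem' := by
    rintro r f ⟨k, hk, hf⟩
    refine ⟨fun a => r • k a, continuous_of_discreteTopology.comp hk (g := fun a : A => r • a),
      fun a b => ?_⟩
    rw [Pi.smul_apply, hf, smul_add, smul_sub, endRing_smul_smul]

/-- The continuous cohomology group `H²(G, A)`, a vector space over `F_A`. -/
abbrev H2 (A : FiniteSimpleModule G) : Type u :=
  A.cocycles₂ ⧸ A.coboundaries₂.submoduleOf A.cocycles₂

end FiniteSimpleModule

namespace GroupCover

variable {G : ProfiniteGrp.{u}}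

/-- The space `Hom_G(Ker π, A)` of the continuous homomorphisms from `Ker π` to `A` that are
`G`-equivariant, where `G` acts on `Ker π` via conjugation by preimages in the total group. -/
def kerHom (π : GroupCover.{u, v} G) (A : FiniteSimpleModule G) :
    Submodule A.endRing (π.ker → A) where
  carrier := {φ | Continuous φ ∧ (∀ x y, φ (x * y) = φ x + φ y) ∧
    ∀ (h : π.total) (x y : π.ker), (y : π.total) = h * x * h⁻¹ → φ y = π.map h • φ x}
  add_mem' := fun {f f'} hf hf' => by
    refine ⟨hf.1.add hf'.1, fun a b => ?_, fun h a b hab => ?_⟩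
    · simp only [Pi.add_apply, hf.2.1, hf'.2.1]
      abel
    · simp only [Pi.add_apply, hf.2.2 h a b hab, hf'.2.2 h a b hab, smul_add]
  zero_mem' := ⟨continuous_const, fun _ _ => by simp, fun _ _ _ _ => by simp⟩
  smul_mem' := fun r f hf => by
    refine ⟨continuous_of_discreteTopology.comp hf.1 (g := fun a : A => r • a),
      fun a b => ?_, fun h a b hab => ?_⟩
    · simp only [Pi.smul_apply, hf.2.1, smul_add]
    · simp only [Pi.smul_apply, hf.2.2 h a b hab, A.endRing_smul_smul]

/-- `Ker π` is abelian and isomorphic to `A` as a `G`-module. -/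
def KerIso (π : GroupCover.{u, v} G) (A : FiniteSimpleModule G) : Prop :=
  ∃ φ ∈ π.kerHom A, Function.Bijective φ

/-- The factor set `(a, b) ↦ s(a) s(b) s(ab)⁻¹` of a section `s` of `π`. -/
def factorSet (π : GroupCover.{u, v} G) (s : G → π.total) (hs : π.IsSection s) (p : G × G) :
    π.ker :=
  ⟨s p.1 * s p.2 * (s (p.1 * p.2))⁻¹, by
    rw [mem_ker, map_mul, map_mul, map_inv, hs.2, hs.2, hs.2, mul_inv_cancel]⟩

theorem continuous_factorSet (π : GroupCover.{u, v} G) (s : G → π.total) (hs : π.IsSection s) :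
    Continuous (π.factorSet s hs) := by
  have h := hs.1
  unfold factorSet
  fun_prop

theorem comp_factorSet_mem (π : GroupCover.{u, v} G) (A : FiniteSimpleModule G)
    (s : G → π.total) (hs : π.IsSection s) (φ : π.kerHom A) :
    (fun p => (φ : π.ker → A) (π.factorSet s hs p)) ∈ A.cocycles₂ := by
  obtain ⟨φ, hc, hmul, heq⟩ := φ
  refine ⟨hc.comp (π.continuous_factorSet s hs), fun a b c => ?_⟩
  have hconj : ∃ y : π.ker, (y : π.total) = s a * (π.factorSet s hs (b, c)) * (s a)⁻¹ :=
    ⟨⟨_, (MonoidHom.normal_ker (π.map : π.total →* G)).conj_mem _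
      (π.factorSet s hs (b, c)).2 (s a)⟩, rfl⟩
  obtain ⟨y, hy⟩ := hconj
  have h1 : φ y = a • φ (π.factorSet s hs (b, c)) := by
    have := heq (s a) _ y hy
    rwa [hs.2] at this
  have h2 : y * π.factorSet s hs (a, b * c) =
      π.factorSet s hs (a, b) * π.factorSet s hs (a * b, c) := by
    apply Subtype.ext
    rw [Subgroup.coe_mul, hy]
    simp only [factorSet, Subgroup.coe_mul, mul_assoc]
    group
  have h3 := congrArg φ h2
  rw [hmul, hmul, h1] at h3
  change a • φ (π.factorSet s hs (b, c)) - φ (π.factorSet s hs (a * b, c)) +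
    φ (π.factorSet s hs (a, b * c)) - φ (π.factorSet s hs (a, b)) = 0
  rw [sub_add_eq_add_sub, h3]
  abel

/-- The `F_A`-linear map `φ ↦ φ ∘ f` from `Hom_G(Ker π, A)` to cocycles, where `f` is the factor
set of a continuous section of `π`. -/
def cocycleMap (π : GroupCover.{u, v} G) (A : FiniteSimpleModule G) (s : G → π.total)
    (hs : π.IsSection s) : π.kerHom A →ₗ[A.endRing] A.cocycles₂ where
  toFun φ := ⟨fun p => (φ : π.ker → A) (π.factorSet s hs p), π.comp_factorSet_mem A s hs φ⟩
  map_add' _ _ := rfl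
  map_smul' _ _ := rfl

/-- The `F_A`-linear map `S : Hom_G(Ker π, A) → H²(G, A)`, `φ ↦ φ_* f`, where `f` is the class of
the extension `π`: `f` is represented by the factor set of a continuous section, and `φ_*` is the
composition of cochains with `φ`. By `classMap_eq`, the choice of the section is irrelevant. -/
noncomputable def classMap (π : GroupCover.{u, v} G) (A : FiniteSimpleModule G) :
    π.kerHom A →ₗ[A.endRing] A.H2 :=
  (Submodule.mkQ (A.coboundaries₂.submoduleOf A.cocycles₂)).comp
    (π.cocycleMap A π.exists_section.choose π.exists_section.choose_spec)

/-- The class map may be computed with any continuous section. -/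
theorem classMap_eq (π : GroupCover.{u, v} G) (A : FiniteSimpleModule G) (φ : π.kerHom A)
    (s : G → π.total) (hs : π.IsSection s) :
    π.classMap A φ = Submodule.Quotient.mk (π.cocycleMap A s hs φ) := by
  rw [classMap, LinearMap.comp_apply, Submodule.mkQ_apply, Submodule.Quotient.eq]
  obtain ⟨hs₀⟩ : Nonempty (π.IsSection π.exists_section.choose) := ⟨π.exists_section.choose_spec⟩
  set s₀ := π.exists_section.choose
  have hk : ∀ a, s₀ a * (s a)⁻¹ ∈ π.ker := fun a => by
    rw [mem_ker, map_mul, map_inv, hs.2, hs₀.2, mul_inv_cancel]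
  obtain ⟨φ, hc, hmul, heq⟩ := φ
  have hcont : Continuous fun a => (⟨s₀ a * (s a)⁻¹, hk a⟩ : π.ker) := by
    have h := hs.1
    have h₀ := hs₀.1
    fun_prop
  refine ⟨fun a => φ ⟨s₀ a * (s a)⁻¹, hk a⟩, hc.comp hcont, fun a b => ?_⟩
  obtain ⟨y, hy⟩ : ∃ y : π.ker, (y : π.total) = s a * (s₀ b * (s b)⁻¹) * (s a)⁻¹ :=
    ⟨⟨_, (MonoidHom.normal_ker (π.map : π.total →* G)).conj_mem _ (hk b) (s a)⟩, rfl⟩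
  have h1 : φ y = a • φ ⟨s₀ b * (s b)⁻¹, hk b⟩ := by
    have := heq (s a) ⟨_, hk b⟩ y hy
    rwa [hs.2] at this
  have h2 : π.factorSet s₀ hs₀ (a, b) * ⟨s₀ (a * b) * (s (a * b))⁻¹, hk (a * b)⟩ =
      ⟨s₀ a * (s a)⁻¹, hk a⟩ * (y * π.factorSet s hs (a, b)) := by
    apply Subtype.ext
    simp only [factorSet, Subgroup.coe_mul, hy]
    group
  have h3 := congrArg φ h2
  rw [hmul, hmul, hmul, h1] at h3
  change φ (π.factorSet s₀ hs₀ (a, b)) - φ (π.factorSet s hs (a, b)) = _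
  rw [eq_sub_of_add_eq h3]
  abel

/-- `π` is (with respect to a suitable identification of `Ker π` with `A`) the extension of `G`
by `A` that corresponds to the cohomology class `c`. -/
def IsExtensionOfClass (π : GroupCover.{u, v} G) (A : FiniteSimpleModule G) (c : A.H2) : Prop :=
  ∃ φ : π.kerHom A, Function.Bijective (φ : π.ker → A) ∧ π.classMap A φ = c

end GroupCover

/-! ### Isomorphism classes and isotypic parts -/

namespace FiniteSimpleModule

variable {G : ProfiniteGrp.{u}}

/-- Isomorphism of finite simple `G`-modules. -/
instance isoSetoid (G : ProfiniteGrp.{u}) : Setoid (FiniteSimpleModule G) where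
  r A B := ∃ e : A ≃+ B, ∀ (g : G) (a : A), e (g • a) = g • e a
  iseqv :=
    { refl := fun A => ⟨AddEquiv.refl A, fun _ _ => rfl⟩
      symm := fun {A B} ⟨e, he⟩ => ⟨e.symm, fun g b => by
        rw [AddEquiv.symm_apply_eq, he, AddEquiv.apply_symm_apply]⟩
      trans := fun {A B C} ⟨e, he⟩ ⟨e', he'⟩ => ⟨e.trans e', fun g a => by
        rw [AddEquiv.trans_apply, he, he', AddEquiv.trans_apply]⟩ }

end FiniteSimpleModule

/-- `Λ_ab(G)`: the isomorphism classes of finite simple `G`-modules. -/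
def LambdaAb (G : ProfiniteGrp.{u}) : Type (u + 1) :=
  Quotient (FiniteSimpleModule.isoSetoid G)

/-- A representative of a class in `Λ_ab(G)`. -/
noncomputable def LambdaAb.rep {G : ProfiniteGrp.{u}} (A : LambdaAb G) : FiniteSimpleModule G :=
  Quotient.out A

/-- The indecomposable covers of `G` with non-abelian kernel. -/
def NonabelianIndecomposable (G : ProfiniteGrp.{u}) : Type (u + 1) :=
  {ζ : GroupCover.{u, u} G // ζ.IsIndecomposable ∧ ¬ ζ.HasAbelianKer}

/-- Isomorphism over `G` of indecomposable covers with non-abelian kernel. -/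
instance NonabelianIndecomposable.isoSetoid (G : ProfiniteGrp.{u}) :
    Setoid (NonabelianIndecomposable G) where
  r ζ ξ := ζ.1.IsoOver ξ.1
  iseqv :=
    { refl := fun ζ => ⟨ContinuousMulEquiv.refl _, fun _ => rfl⟩
      symm := fun {ζ ξ} ⟨e, he⟩ => ⟨e.symm, fun h => by
        rw [← he, ContinuousMulEquiv.apply_symm_apply]⟩
      trans := fun {ζ ξ χ} ⟨e, he⟩ ⟨e', he'⟩ => ⟨e.trans e', fun h => by
        rw [ContinuousMulEquiv.trans_apply, he', he]⟩ }

/-- `Λ_na(G)`: the isomorphism classes of indecomposable covers of `G` with non-abelian kernel. -/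
def LambdaNa (G : ProfiniteGrp.{u}) : Type (u + 1) :=
  Quotient (NonabelianIndecomposable.isoSetoid G)

/-- A representative of a class in `Λ_na(G)`. -/
noncomputable def LambdaNa.rep {G : ProfiniteGrp.{u}} (ζ : LambdaNa G) : GroupCover.{u, u} G :=
  (Quotient.out ζ).1

namespace GroupCover

variable {G : ProfiniteGrp.{u}}

/-- `𝒞_ζ`: the closed normal subgroups `N ≤ Ker π` of `H` such that `H ⧸ N → G` is isomorphic to
`ζ` over `G`. -/
def naSet (π : GroupCover.{u, v} G) (ζ : GroupCover.{u, w} G) : Set (Subgroup π.total) :=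
  {N | ∃ hN : π.IsSubKernel N, (π.quot N hN).IsoOver ζ}

/-- `𝒞_A`: the closed normal subgroups `N ≤ Ker π` of `H` such that the kernel of `H ⧸ N → G` is
isomorphic to `A` as a `G`-module. -/
def abSet (π : GroupCover.{u, v} G) (A : FiniteSimpleModule G) : Set (Subgroup π.total) :=
  {N | ∃ hN : π.IsSubKernel N, (π.quot N hN).KerIso A}

/-- `H_ζ → G`, where `H_ζ = H ⧸ N_ζ` and `N_ζ` is the intersection, inside `Ker π`, of `𝒞_ζ`.
(If `𝒞_ζ` is empty, then `N_ζ = Ker π` and `H_ζ = G`.) -/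
noncomputable def naPart (π : GroupCover.{u, v} G) (ζ : GroupCover.{u, w} G) :
    GroupCover.{u, v} G :=
  π.quot (π.ker ⊓ sInf (π.naSet ζ)) (π.isSubKernel_inter (π.naSet ζ) fun _ hN => hN.1)

/-- `H_A → G`, where `H_A = H ⧸ N_A` and `N_A` is the intersection, inside `Ker π`, of `𝒞_A`.
(If `𝒞_A` is empty, then `N_A = Ker π` and `H_A = G`.) -/
noncomputable def abPart (π : GroupCover.{u, v} G) (A : FiniteSimpleModule G) :
    GroupCover.{u, v} G :=
  π.quot (π.ker ⊓ sInf (π.abSet A)) (π.isSubKernel_inter (π.abSet A) fun _ hN => hN.1)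

/-- `H_λ → G` for `λ` in `Λ(G) = Λ_na(G) ⊔ Λ_ab(G)`. -/
noncomputable def isotypicPart (π : GroupCover.{u, v} G) :
    LambdaNa G ⊕ LambdaAb G → GroupCover.{u, v} G
  | Sum.inl ζ => π.naPart ζ.rep
  | Sum.inr A => π.abPart A.rep

/-- `B_A^* = Hom_G(B_A, A)`, where `B_A` is the kernel of `H_A → G`; a vector space over `F_A`. -/
noncomputable abbrev dualB (π : GroupCover.{u, v} G) (A : FiniteSimpleModule G) :
    Submodule A.endRing ((π.abPart A).ker → A) :=
  (π.abPart A).kerHom A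

/-- The `F_A`-linear map `S_A : B_A^* → H²(G, A)`, `φ ↦ φ_* f_A`, where `f_A` is the class of the
extension `1 → B_A → H_A → G → 1`. -/
noncomputable abbrev S (π : GroupCover.{u, v} G) (A : FiniteSimpleModule G) :
    π.dualB A →ₗ[A.endRing] A.H2 :=
  (π.abPart A).classMap A

end GroupCover

-- Everything takes place in the lattice of closed normal subgroups of `H` below `Ker π`, whose
-- maximal proper members are called coatoms here. A quotient `H ⧸ N → G` is indecomposable exactly
-- when `N` is a coatom (`isIndecomposable_iff_mem_coatoms`), so `π` is fundamental exactly when its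
-- indecomposable quotients separate the points of `Ker π`. What remains is independence: which
-- families of maps over `G` are jointly surjective, that is, map onto the fiber product.
-- Compactness reduces this to finite subfamilies (`jointlySurjective_of_finset`). Since every
-- proper closed normal subgroup lies in a coatom, it is then enough that no coatom contains both
-- the kernel of one member and the intersection of the kernels of finitely many others
-- (`jointlySurjective_of_coatoms`).
--
-- Let a coatom `M` contain a finite intersection of coatoms. If `Ker π / M` is non-abelian, then
-- `M` is prime in the lattice by a commutator argument, hence is one of them
-- (`exists_le_of_finset_inf_le`). If `Ker π / M` is a finite simple module `A`, then primality may
-- fail, but at least one of the given coatoms is of type `A` (`exists_mem_abSet_of_finset`). As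
-- each coatom has exactly one type, the parts `H_λ` for different `λ` are independent;
-- fundamentality makes them separate points, which gives the decomposition.
--
-- Within a non-abelian type `ζ`, primality makes distinct members of `𝒞_ζ` independent. Within an
-- abelian type `A`, the problem becomes linear algebra over `F_A`: the members of `𝒞_A` are the
-- kernels of the nonzero equivariant homomorphisms `Ker π → A`, linear independence amounts to
-- joint surjectivity by a Schur-type argument (`mem_span_of_finset`), and spanning gives joint
-- injectivity. Equality of cohomology classes produces homomorphisms over `G`
-- (`exists_overHom_of_classMap_eq`), so any extension of class `S_A(φ_i)` can replace the quotient
-- by the kernel of `φ_i`.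
--
-- Conversely, the projections of a fiber product are surjective and jointly injective, and for
-- indecomposable factors their kernels are coatoms.

universe v₁ v₂ v₃

namespace GroupCover

variable {G : ProfiniteGrp.{u}}

/-! ### Homomorphisms over the base group -/

/-- A continuous homomorphism between the total groups of two covers, over `G`. -/
structure OverHom (π : GroupCover.{u, v₁} G) (η : GroupCover.{u, v₂} G) where
  hom : π.total →ₜ* η.total
  comm : ∀ h, η.map (hom h) = π.map h

namespace OverHom

variable {π : GroupCover.{u, v₁} G} {η : GroupCover.{u, v₂} G} {ρ : GroupCover.{u, v₃} G}

instance : CoeFun (OverHom π η) fun _ => π.total → η.total := ⟨fun p => p.hom⟩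

theorem map_mul (p : OverHom π η) (x y : π.total) : p (x * y) = p x * p y :=
  _root_.map_mul p.hom x y

theorem map_inv (p : OverHom π η) (x : π.total) : p x⁻¹ = (p x)⁻¹ := _root_.map_inv p.hom x

theorem map_one (p : OverHom π η) : p 1 = 1 := _root_.map_one p.hom

theorem continuous (p : OverHom π η) : Continuous p := p.hom.continuous_toFun

theorem isClosedMap (p : OverHom π η) : IsClosedMap p := p.continuous.isClosedMap

/-- Composition of homomorphisms over `G`. -/
def comp (q : OverHom η ρ) (p : OverHom π η) : OverHom π ρ where
  hom := q.hom.comp p.hom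
  comm h := (q.comm _).trans (p.comm h)

theorem comp_apply (q : OverHom η ρ) (p : OverHom π η) (h : π.total) : q.comp p h = q (p h) := rfl

theorem mem_ker_iff (p : OverHom π η) {h : π.total} : p h ∈ η.ker ↔ h ∈ π.ker := by
  rw [mem_ker, mem_ker, p.comm]

/-- The kernel of a homomorphism over `G`. -/
def kernel (p : OverHom π η) : Subgroup π.total := MonoidHom.ker (p.hom : π.total →* η.total)

theorem mem_kernel (p : OverHom π η) {h : π.total} : h ∈ p.kernel ↔ p h = 1 := Iff.rfl

theorem kernel_le (p : OverHom π η) : p.kernel ≤ π.ker := fun h hh => by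
  rw [← p.mem_ker_iff, p.mem_kernel.1 hh]
  exact one_mem _

theorem isClosed_kernel (p : OverHom π η) : IsClosed (p.kernel : Set π.total) :=
  isClosed_singleton.preimage p.continuous

theorem isSubKernel_kernel (p : OverHom π η) : π.IsSubKernel p.kernel where
  normal := MonoidHom.normal_ker _
  closed := p.isClosed_kernel
  le := p.kernel_le

theorem injective_iff (p : OverHom π η) : Function.Injective p ↔ ∀ h, p h = 1 → h = 1 :=
  injective_iff_map_eq_one p.hom

theorem exists_mem_ker (p : OverHom π η) (hp : Function.Surjective p) {y : η.total}
    (hy : y ∈ η.ker) : ∃ x ∈ π.ker, p x = y := by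
  obtain ⟨x, rfl⟩ := hp y
  exact ⟨x, p.mem_ker_iff.1 hy, rfl⟩

/-- A homomorphism over `G` factors through a surjective one with smaller kernel. -/
theorem exists_factor (p : OverHom π η) (hp : Function.Surjective p) (q : OverHom π ρ)
    (h : p.kernel ≤ q.kernel) : ∃ r : OverHom η ρ, ∀ x, r (p x) = q x := by
  have hwd : ∀ x y, p x = p y → q x = q y := by
    intro x y hxy
    have : x⁻¹ * y ∈ q.kernel := h (by rw [mem_kernel, p.map_mul, p.map_inv, hxy, inv_mul_cancel])
    rw [mem_kernel, q.map_mul, q.map_inv] at this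
    exact inv_mul_eq_one.1 this
  choose s hs using hp
  have hr : ∀ x, q (s (p x)) = q x := fun x => hwd _ _ (hs _)
  refine ⟨⟨⟨⟨⟨fun y => q (s y), ?_⟩, ?_⟩, ?_⟩, ?_⟩, hr⟩
  · rw [← q.map_one]
    exact hwd _ _ (by rw [hs, p.map_one])
  · intro a b
    change q (s (a * b)) = q (s a) * q (s b)
    rw [← q.map_mul]
    exact hwd _ _ (by rw [hs, p.map_mul, hs, hs])
  -- The set-theoretic section `s` need not be continuous; continuity of `q ∘ s` comes from `p`
  -- being a closed surjection, hence a quotient map.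
  · have hq : Topology.IsQuotientMap p :=
      p.isClosedMap.isQuotientMap p.continuous fun y => ⟨s y, hs y⟩
    change Continuous fun y => q (s y)
    rw [hq.continuous_iff]
    exact q.continuous.congr fun x => (hr x).symm
  · intro y
    change ρ.map (q (s y)) = η.map y
    rw [q.comm, ← p.comm, hs]

end OverHom

/-- The inverse is automatically continuous: the source is compact and the target Hausdorff. -/
theorem isoOver_of_bijective {π : GroupCover.{u, v₁} G} {η : GroupCover.{u, v₂} G}
    (p : OverHom π η) (hp : Function.Bijective p) : π.IsoOver η :=
  ⟨{ MulEquiv.ofBijective p.hom hp with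
      continuous_toFun := p.continuous
      continuous_invFun := (p.continuous.homeoOfEquivCompactToT2
        (f := Equiv.ofBijective p hp)).continuous_symm }, p.comm⟩

namespace IsoOver

variable {π : GroupCover.{u, v₁} G} {η : GroupCover.{u, v₂} G} {ρ : GroupCover.{u, v₃} G}

theorem symm (h : π.IsoOver η) : η.IsoOver π := by
  obtain ⟨e, he⟩ := h
  exact ⟨e.symm, fun h => by rw [← he, ContinuousMulEquiv.apply_symm_apply]⟩

theorem trans (h : π.IsoOver η) (h' : η.IsoOver ρ) : π.IsoOver ρ := by
  obtain ⟨e, he⟩ := h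
  obtain ⟨e', he'⟩ := h'
  exact ⟨e.trans e', fun h => by rw [ContinuousMulEquiv.trans_apply, he', he]⟩

theorem exists_overHom (h : π.IsoOver η) : ∃ p : OverHom π η, Function.Bijective p := by
  obtain ⟨e, he⟩ := h
  exact ⟨⟨⟨e.toMulEquiv.toMonoidHom, e.continuous_toFun⟩, he⟩, e.bijective⟩

end IsoOver

/-! ### Quotient maps -/

/-- The quotient map from a cover to its quotient cover. -/
def quotHom (π : GroupCover.{u, v} G) (N : Subgroup π.total) (hN : π.IsSubKernel N) :
    OverHom π (π.quot N hN) :=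
  haveI := hN.normal
  { hom :=
      { toMonoidHom := QuotientGroup.mk' N
        continuous_toFun := continuous_quotient_mk' }
    comm := fun _ => rfl }

theorem quotHom_surjective (π : GroupCover.{u, v} G) (N : Subgroup π.total)
    (hN : π.IsSubKernel N) : Function.Surjective (π.quotHom N hN) :=
  QuotientGroup.mk_surjective

theorem kernel_quotHom (π : GroupCover.{u, v} G) (N : Subgroup π.total)
    (hN : π.IsSubKernel N) : (π.quotHom N hN).kernel = N :=
  haveI := hN.normal
  QuotientGroup.ker_mk' N

theorem quotHom_eq_one_iff (π : GroupCover.{u, v} G) (N : Subgroup π.total)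
    (hN : π.IsSubKernel N) {x : π.total} : π.quotHom N hN x = 1 ↔ x ∈ N := by
  rw [← OverHom.mem_kernel, kernel_quotHom]

theorem quot_isoOver_of_kernel_eq {π : GroupCover.{u, v₁} G} {η : GroupCover.{u, v₂} G}
    (p : OverHom π η) (hp : Function.Surjective p) (N : Subgroup π.total)
    (hN : π.IsSubKernel N) (h : p.kernel = N) : (π.quot N hN).IsoOver η := by
  obtain ⟨r, hr⟩ := (π.quotHom N hN).exists_factor (π.quotHom_surjective N hN) p
    (by rw [kernel_quotHom, h])
  refine isoOver_of_bijective r ⟨r.injective_iff.2 fun y hy => ?_, fun y => ?_⟩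
  · obtain ⟨x, rfl⟩ := π.quotHom_surjective N hN y
    rw [hr] at hy
    rw [quotHom_eq_one_iff, ← h]
    exact hy
  · obtain ⟨x, rfl⟩ := hp y
    exact ⟨_, hr x⟩

/-! ### Recognizing fiber products -/

/-- The projection from a fiber product to a factor. -/
noncomputable def proj {I : Type w} (E : I → GroupCover.{u, v} G) (i : I) :
    OverHom (fiberProduct E) (E i) where
  hom :=
    { toMonoidHom := ((Pi.evalMonoidHom (fun i => ((E i).total : Type v)) i).comp
        (MonoidHom.snd G ((i : I) → (E i).total))).comp (fiberSubgroup E).subtype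
      continuous_toFun := (continuous_apply i).comp (continuous_snd.comp continuous_subtype_val) }
  comm h := h.2 i

/-- A family of homomorphisms over `G` is jointly surjective if the induced map to the fiber
product is surjective. -/
def JointlySurjective {π : GroupCover.{u, v₁} G} {I : Type w} {E : I → GroupCover.{u, v} G}
    (ψ : ∀ i, OverHom π (E i)) : Prop :=
  ∀ (g : G) (y : ∀ i, (E i).total), (∀ i, (E i).map (y i) = g) →
    ∃ x, π.map x = g ∧ ∀ i, ψ i x = y i

/-- A family of homomorphisms over `G` is jointly injective if the induced map to the fiber
product is injective. -/
def JointlyInjective {π : GroupCover.{u, v₁} G} {I : Type w} {E : I → GroupCover.{u, v} G}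
    (ψ : ∀ i, OverHom π (E i)) : Prop :=
  ∀ x ∈ π.ker, (∀ i, ψ i x = 1) → x = 1

section FiberProduct

variable {π : GroupCover.{u, v₁} G} {I : Type w} {E : I → GroupCover.{u, v} G}

theorem jointlySurjective_proj (E : I → GroupCover.{u, v} G) : JointlySurjective (proj E) :=
  fun g y h => ⟨⟨(g, y), h⟩, rfl, fun _ => rfl⟩

theorem jointlyInjective_proj (E : I → GroupCover.{u, v} G) : JointlyInjective (proj E) :=
  fun _ hx h => Subtype.ext (Prod.ext hx (funext h))

/-- The homomorphism to a fiber product given by a family of homomorphisms to the factors. -/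
noncomputable def fiberLift (ψ : ∀ i, OverHom π (E i)) : OverHom π (fiberProduct E) where
  hom :=
    { toFun := fun x => ⟨(π.map x, fun i => ψ i x), fun i => (ψ i).comm x⟩
      map_one' := Subtype.ext (Prod.ext (map_one π.map) (funext fun i => (ψ i).map_one))
      map_mul' := fun x y => Subtype.ext (Prod.ext (map_mul π.map x y)
        (funext fun i => (ψ i).map_mul x y))
      continuous_toFun := Continuous.subtype_mk (π.map.continuous_toFun.prodMk
        (continuous_pi fun i => (ψ i).continuous)) _ }
  comm := fun _ => rfl

theorem proj_fiberLift (ψ : ∀ i, OverHom π (E i)) (x : π.total) (i : I) :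
    proj E i (fiberLift ψ x) = ψ i x := rfl

theorem fiberProduct_ext {x y : (fiberProduct E).total}
    (h : (fiberProduct E).map x = (fiberProduct E).map y) (hi : ∀ i, proj E i x = proj E i y) :
    x = y :=
  Subtype.ext (Prod.ext h (funext hi))

theorem isoOver_fiberProduct (ψ : ∀ i, OverHom π (E i)) (hs : JointlySurjective ψ)
    (hi : JointlyInjective ψ) : π.IsoOver (fiberProduct E) := by
  refine isoOver_of_bijective (fiberLift ψ) ⟨(OverHom.injective_iff _).2 fun x hx => ?_,
    fun y => ?_⟩
  · refine hi x ((fiberLift ψ).kernel_le hx) fun i => ?_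
    rw [← proj_fiberLift, hx, OverHom.map_one]
  · obtain ⟨x, hx, hxi⟩ := hs _ (fun i => proj E i y) fun i => (proj E i).comm y
    exact ⟨x, fiberProduct_ext hx hxi⟩

/-- Recognition of a fiber product of two covers. -/
theorem isoOver_fiberProduct_bool {X Y : GroupCover.{u, v} G} (p : OverHom π X) (q : OverHom π Y)
    (hs : ∀ x y, X.map x = Y.map y → ∃ z, p z = x ∧ q z = y)
    (hi : ∀ z, p z = 1 → q z = 1 → z = 1) :
    π.IsoOver (fiberProduct fun b : Bool => if b then X else Y) := by
  refine isoOver_fiberProduct (fun | true => p | false => q) (fun g y hy => ?_) fun z _ hz => ?_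
  · obtain ⟨z, hz, hz'⟩ := hs (y true) (y false) ((hy true).trans (hy false).symm)
    refine ⟨z, ?_, fun | true => hz | false => hz'⟩
    rw [← p.comm, hz]
    exact hy true
  · exact hi z (hz true) (hz false)

theorem IsoOver.exists_family (h : π.IsoOver (fiberProduct E)) :
    ∃ ψ : ∀ i, OverHom π (E i), JointlySurjective ψ ∧ JointlyInjective ψ := by
  obtain ⟨p, hp⟩ := h.exists_overHom
  refine ⟨fun i => (proj E i).comp p, fun g y hy => ?_, fun x hx hxi => ?_⟩
  · obtain ⟨z, hz, hzi⟩ := jointlySurjective_proj E g y hy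
    obtain ⟨x, rfl⟩ := hp.2 z
    exact ⟨x, (p.comm x).symm.trans hz, hzi⟩
  · exact p.injective_iff.1 hp.1 x (jointlyInjective_proj E _ (p.mem_ker_iff.2 hx) hxi)

theorem JointlySurjective.exists_mem_ker {ψ : ∀ i, OverHom π (E i)} (hs : JointlySurjective ψ)
    (y : ∀ i, (E i).total) (hy : ∀ i, y i ∈ (E i).ker) : ∃ x ∈ π.ker, ∀ i, ψ i x = y i :=
  hs 1 y hy

open Classical in
theorem JointlySurjective.exists_single {ψ : ∀ i, OverHom π (E i)} (hs : JointlySurjective ψ)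
    (j : I) (y : (E j).total) (hy : y ∈ (E j).ker) :
    ∃ x ∈ π.ker, ψ j x = y ∧ ∀ i ≠ j, ψ i x = 1 := by
  obtain ⟨x, hx, hxi⟩ := hs.exists_mem_ker (Function.update (fun _ => 1) j y) fun i => by
    by_cases h : i = j
    · subst h
      simpa using hy
    · rw [Function.update_of_ne h]
      exact one_mem _
  exact ⟨x, hx, by simpa using hxi j, fun i h => by simpa [h] using hxi i⟩

theorem JointlySurjective.surjective {ψ : ∀ i, OverHom π (E i)} (hs : JointlySurjective ψ)
    (i : I) : Function.Surjective (ψ i) := by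
  classical
  intro y
  choose z hz using fun j => (E j).surj ((E i).map y)
  obtain ⟨x, -, hx⟩ := hs ((E i).map y) (Function.update z i y) fun j => by
    by_cases h : j = i
    · subst h
      simp
    · rw [Function.update_of_ne h, hz]
  exact ⟨x, by simpa using hx i⟩

open Classical in
/-- Joint surjectivity may be checked on finite subfamilies. -/
theorem jointlySurjective_of_finset (ψ : ∀ i, OverHom π (E i))
    (h : ∀ (F : Finset I) (j : I), j ∉ F → ∀ y ∈ (E j).ker,
      ∃ x ∈ π.ker, ψ j x = y ∧ ∀ i ∈ F, ψ i x = 1) : JointlySurjective ψ := by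
  intro g y hy
  have hfin : ∀ F : Finset I, ∃ x, π.map x = g ∧ ∀ i ∈ F, ψ i x = y i := by
    intro F
    induction F using Finset.induction_on with
    | empty => exact (π.surj g).imp fun x hx => ⟨hx, by simp⟩
    | insert j F hj ih =>
      obtain ⟨x, hx, hxF⟩ := ih
      -- Right multiplication by `z` corrects coordinate `j` and leaves the coordinates in `F` and
      -- the image in `G` unchanged.
      obtain ⟨z, hz, hzj, hzF⟩ := h F j hj ((ψ j x)⁻¹ * y j) (by
        rw [mem_ker, map_mul, map_inv, (ψ j).comm, hy, hx, inv_mul_cancel])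
      refine ⟨x * z, by rw [map_mul, hx, π.mem_ker.1 hz, mul_one], fun i hi => ?_⟩
      rw [(ψ i).map_mul]
      rcases Finset.mem_insert.1 hi with rfl | hi
      · rw [hzj, mul_inv_cancel_left]
      · rw [hxF i hi, hzF i hi, mul_one]
  have hcl : ∀ F : Finset I, IsClosed {x | π.map x = g ∧ ∀ i ∈ F, ψ i x = y i} := by
    intro F
    have hE : {x | π.map x = g ∧ ∀ i ∈ F, ψ i x = y i} =
        π.map ⁻¹' {g} ∩ ⋂ i ∈ F, (ψ i) ⁻¹' {y i} := by
      ext x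
      simp
    rw [hE]
    exact (isClosed_singleton.preimage π.map.continuous_toFun).inter
      (isClosed_biInter fun i _ => isClosed_singleton.preimage (ψ i).continuous)
  -- The solution sets for finite `F` are nonempty, compact and directed, so they have a common
  -- point.
  obtain ⟨x, hx⟩ := IsCompact.nonempty_iInter_of_directed_nonempty_isCompact_isClosed
    (fun F : Finset I => {x | π.map x = g ∧ ∀ i ∈ F, ψ i x = y i})
    (fun F F' => ⟨F ∪ F', fun x hx => ⟨hx.1, fun i hi => hx.2 i (Finset.mem_union_left _ hi)⟩,
      fun x hx => ⟨hx.1, fun i hi => hx.2 i (Finset.mem_union_right _ hi)⟩⟩)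
    (fun F => hfin F) (fun F => (hcl F).isCompact) hcl
  rw [Set.mem_iInter] at hx
  exact ⟨x, (hx ∅).1, fun i => (hx {i}).2 i (Finset.mem_singleton_self i)⟩

/-- One coordinate can be prescribed with all the others trivial, so the finite criterion passes to
subfamilies; injectivity of `f` prevents a coordinate from being prescribed twice. -/
theorem JointlySurjective.comp_injective {ψ : ∀ i, OverHom π (E i)} (hs : JointlySurjective ψ)
    {J : Type*} {f : J → I} (hf : Function.Injective f) :
    JointlySurjective fun j => ψ (f j) := by
  refine jointlySurjective_of_finset _ fun F j hj y hy => ?_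
  obtain ⟨x, hx, hxj, hxi⟩ := hs.exists_single (f j) y hy
  exact ⟨x, hx, hxj, fun i hi => hxi _ (hf.ne (by rintro rfl; exact hj hi))⟩

/-- A quotient of a cover by the joint kernel of a jointly surjective family is the fiber
product. -/
theorem quot_isoOver_fiberProduct (ψ : ∀ i, OverHom π (E i)) (hs : JointlySurjective ψ)
    (N : Subgroup π.total) (hN : π.IsSubKernel N)
    (h : ∀ x ∈ π.ker, x ∈ N ↔ ∀ i, ψ i x = 1) : (π.quot N hN).IsoOver (fiberProduct E) := by
  choose r hr using fun i => (π.quotHom N hN).exists_factor (π.quotHom_surjective N hN) (ψ i)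
    (by rw [kernel_quotHom]; exact fun x hx => (h x (hN.le hx)).1 hx i)
  refine isoOver_fiberProduct r (fun g y hy => ?_) fun x hx hxi => ?_
  · obtain ⟨x, hx, hxi⟩ := hs g y hy
    exact ⟨π.quotHom N hN x, by rw [OverHom.comm, hx], fun i => by rw [hr, hxi]⟩
  · obtain ⟨x, rfl⟩ := π.quotHom_surjective N hN x
    rw [OverHom.mem_ker_iff] at hx
    rw [quotHom_eq_one_iff, h x hx]
    intro i
    rw [← hr, hxi]

end FiberProduct

/-! ### Maximal closed normal subgroups below the kernel -/

/-- The closed normal subgroups that are maximal among those strictly contained in the kernel. -/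
abbrev coatoms (π : GroupCover.{u, v} G) : Set (Subgroup π.total) :=
  maxNormalBelow π.total π.ker

theorem normal_ker (π : GroupCover.{u, v} G) : π.ker.Normal :=
  MonoidHom.normal_ker (π.map : π.total →* G)

theorem isClosed_ker (π : GroupCover.{u, v} G) : IsClosed (π.ker : Set π.total) :=
  isClosed_singleton.preimage π.map.continuous_toFun

section Coatoms

variable {π : GroupCover.{u, v} G} {M N : Subgroup π.total}

theorem mem_coatoms_iff : M ∈ π.coatoms ↔ π.IsSubKernel M ∧ M ≠ π.ker ∧
    ∀ L, π.IsSubKernel L → M ≤ L → L = M ∨ L = π.ker := by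
  constructor
  · rintro ⟨⟨hn, hc, hlt⟩, hmax⟩
    refine ⟨⟨hn, hc, hlt.le⟩, hlt.ne, fun L hL hML => ?_⟩
    by_cases h : L = π.ker
    · exact Or.inr h
    · exact Or.inl (le_antisymm (hmax ⟨hL.normal, hL.closed, lt_of_le_of_ne hL.le h⟩ hML) hML)
  · rintro ⟨hM, hne, hmax⟩
    refine ⟨⟨hM.normal, hM.closed, lt_of_le_of_ne hM.le hne⟩, fun L hL hML => ?_⟩
    rcases hmax L ⟨hL.1, hL.2.1, hL.2.2.le⟩ hML with h | h
    · exact h.le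
    · exact absurd h hL.2.2.ne

theorem isSubKernel_of_mem_coatoms (h : M ∈ π.coatoms) : π.IsSubKernel M :=
  (mem_coatoms_iff.1 h).1

theorem ne_ker_of_mem_coatoms (h : M ∈ π.coatoms) : M ≠ π.ker :=
  (mem_coatoms_iff.1 h).2.1

theorem eq_or_eq_of_mem_coatoms (h : M ∈ π.coatoms) {L : Subgroup π.total}
    (hL : π.IsSubKernel L) (hML : M ≤ L) : L = M ∨ L = π.ker :=
  (mem_coatoms_iff.1 h).2.2 L hL hML

theorem eq_of_le_of_mem_coatoms (hM : M ∈ π.coatoms) (hN : N ∈ π.coatoms) (h : M ≤ N) : M = N :=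
  ((eq_or_eq_of_mem_coatoms hM (isSubKernel_of_mem_coatoms hN) h).resolve_right
    (ne_ker_of_mem_coatoms hN)).symm

theorem isFundamental_iff : π.IsFundamental ↔
    ∀ x ∈ π.ker, (∀ M ∈ π.coatoms, x ∈ M) → x = 1 := by
  rw [IsFundamental, fundamentKer, eq_bot_iff]
  constructor
  · intro h x hx hxM
    exact Subgroup.mem_bot.1 (h ⟨hx, Subgroup.mem_sInf.2 hxM⟩)
  · intro h x hx
    exact Subgroup.mem_bot.2 (h x hx.1 (Subgroup.mem_sInf.1 hx.2))

theorem IsSubKernel.inf (hM : π.IsSubKernel M) (hN : π.IsSubKernel N) : π.IsSubKernel (M ⊓ N) where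
  normal := by
    have := hM.normal
    have := hN.normal
    infer_instance
  closed := hM.closed.inter hN.closed
  le := inf_le_left.trans hM.le

theorem isSubKernel_ker : π.IsSubKernel π.ker :=
  ⟨π.normal_ker, π.isClosed_ker, le_rfl⟩

theorem IsSubKernel.sup (hM : π.IsSubKernel M) (hN : π.IsSubKernel N) :
    π.IsSubKernel (M ⊔ N) where
  normal := by
    have := hM.normal
    have := hN.normal
    infer_instance
  closed := by
    have := hN.normal
    rw [Subgroup.mul_normal]
    exact (hM.closed.isCompact.mul hN.closed.isCompact).isClosed
  le := sup_le hM.le hN.le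

theorem IsSubKernel.mem_sup_iff (hN : π.IsSubKernel N) {k : π.total} :
    k ∈ M ⊔ N ↔ ∃ x ∈ M, ∃ y ∈ N, x * y = k := by
  have := hN.normal
  rw [← SetLike.mem_coe, Subgroup.mul_normal]
  rfl

/-- The elements of the kernel lying in all members of a finite set of subgroups. -/
theorem isSubKernel_finset {ι : Type*} (F : Finset ι) (N : ι → Subgroup π.total)
    (h : ∀ i ∈ F, π.IsSubKernel (N i)) : π.IsSubKernel (π.ker ⊓ F.inf N) := by
  classical
  induction F using Finset.induction_on with
  | empty =>
    rw [Finset.inf_empty, inf_top_eq]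
    exact isSubKernel_ker
  | insert j F hj ih =>
    rw [Finset.inf_insert, inf_left_comm]
    exact (h j (Finset.mem_insert_self j F)).inf
      (ih fun i hi => h i (Finset.mem_insert_of_mem hi))

theorem mem_finset_inf_iff {ι : Type*} (F : Finset ι) (N : ι → Subgroup π.total) {x : π.total} :
    x ∈ F.inf N ↔ ∀ i ∈ F, x ∈ N i := by
  classical
  induction F using Finset.induction_on with
  | empty => simp
  | insert j F hj ih => simp [Finset.inf_insert, ih]

/-- A closed normal subgroup that is not contained in a coatom generates with it the kernel. -/
theorem exists_mul_of_mem_coatoms (hM : M ∈ π.coatoms) (hN : π.IsSubKernel N) (h : ¬ N ≤ M)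
    {k : π.total} (hk : k ∈ π.ker) : ∃ x ∈ N, ∃ y ∈ M, x * y = k := by
  have hMs := isSubKernel_of_mem_coatoms hM
  rw [← hMs.mem_sup_iff]
  rcases eq_or_eq_of_mem_coatoms hM (hN.sup hMs) le_sup_right with h' | h'
  · exact absurd (le_sup_left.trans h'.le) h
  · rwa [h']

/-- A proper closed normal subgroup `N` of the kernel remains proper modulo some open normal
subgroup. -/
theorem IsSubKernel.exists_open (hN : π.IsSubKernel N) (hne : N ≠ π.ker) :
    ∃ U : OpenNormalSubgroup π.total, ¬ π.ker ≤ N ⊔ (U : Subgroup π.total) := by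
  obtain ⟨k, hk, hkN⟩ := Set.exists_of_ssubset (lt_of_le_of_ne hN.le hne : N < π.ker)
  -- This is the set of `x` with `k * x ∉ N`, a neighbourhood of `1`. An open normal `U` inside it
  -- satisfies `k ∉ N U`.
  have hO : IsOpen ((fun x => k * x) ⁻¹' (N : Set π.total)ᶜ) :=
    hN.closed.isOpen_compl.preimage (continuous_const_mul k)
  obtain ⟨U, hU⟩ := ProfiniteGrp.exist_openNormalSubgroup_sub_open_nhds_of_one hO
    (by simpa using hkN)
  refine ⟨U, fun h => ?_⟩
  have hkU := h hk
  rw [← SetLike.mem_coe, Subgroup.mul_normal] at hkU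
  obtain ⟨x, hx, y, hy, hxy⟩ := hkU
  have := hU (show y⁻¹ ∈ (U : Set π.total) from inv_mem hy)
  apply this
  change k * y⁻¹ ∈ N
  rw [← hxy]
  simpa using hx

/-- By the modular law `L = K ∩ LU`, and `LU` is open, hence also closed. Closedness of `K \ L` is
what later compactness arguments need. -/
theorem isClosed_of_open_inf_le {L K : Subgroup π.total} (hK : IsClosed (K : Set π.total))
    (U : OpenNormalSubgroup π.total) (hL : L ≤ K) (h : (U : Subgroup π.total) ⊓ K ≤ L) :
    IsClosed (L : Set π.total) ∧ IsClosed ((K : Set π.total) \ L) := by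
  have hop : IsOpen ((L ⊔ (U : Subgroup π.total) : Subgroup π.total) : Set π.total) :=
    Subgroup.isOpen_mono le_sup_right U.isOpen'
  have hcl := Subgroup.isClosed_of_isOpen _ hop
  have hE : (L : Set π.total) =
      (K : Set π.total) ∩ ((L ⊔ (U : Subgroup π.total) : Subgroup π.total) : Set π.total) := by
    ext x
    refine ⟨fun hx => ⟨hL hx, le_sup_left (a := L) hx⟩, ?_⟩
    rintro ⟨hxK, hx⟩
    rw [Subgroup.mul_normal] at hx
    obtain ⟨a, ha, b, hb, rfl⟩ := hx
    exact mul_mem ha (h ⟨hb, (K.mul_mem_cancel_left (hL ha)).1 hxK⟩)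
  refine ⟨by rw [hE]; exact hK.inter hcl, ?_⟩
  rw [hE, Set.sdiff_self_inter]
  exact hK.sdiff hop

/-- A coatom is open in the kernel. -/
theorem exists_open_inf_le (hM : M ∈ π.coatoms) :
    ∃ U : OpenNormalSubgroup π.total, (U : Subgroup π.total) ⊓ π.ker ≤ M := by
  have hMs := isSubKernel_of_mem_coatoms hM
  have := hMs.normal
  have := π.normal_ker
  obtain ⟨U, hU⟩ := hMs.exists_open (ne_ker_of_mem_coatoms hM)
  -- `MU ∩ Ker π` lies between `M` and `Ker π`, and differs from the latter by the choice of `U`;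
  -- maximality makes it equal to `M`.
  have hs : π.IsSubKernel ((M ⊔ (U : Subgroup π.total)) ⊓ π.ker) :=
    { normal := inferInstance
      closed := (Subgroup.isClosed_of_isOpen _
        (Subgroup.isOpen_mono le_sup_right U.isOpen')).inter π.isClosed_ker
      le := inf_le_right }
  refine ⟨U, ?_⟩
  rcases eq_or_eq_of_mem_coatoms hM hs (le_inf le_sup_left hMs.le) with h | h
  · exact (inf_le_inf_right _ le_sup_right).trans h.le
  · exact absurd (inf_eq_right.1 h) hU

/-- Every closed normal subgroup strictly contained in the kernel lies in a coatom. -/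
theorem IsSubKernel.exists_le_coatom (hN : π.IsSubKernel N) (hne : N ≠ π.ker) :
    ∃ M ∈ π.coatoms, N ≤ M := by
  have := hN.normal
  have := π.normal_ker
  obtain ⟨U, hU⟩ := hN.exists_open hne
  let Q := π.total ⧸ (U : Subgroup π.total)
  have hfin : Finite Q := inferInstanceAs (Finite (π.total ⧸ U.toOpenSubgroup.toSubgroup))
  -- A finite set replaces Zorn's lemma: its members are determined by their images in the finite
  -- group `H ⧸ U`. Closedness need not be imposed, as it follows from containing `U ⊓ Ker π`.
  let 𝒮 : Set (Subgroup π.total) :=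
    {L | L.Normal ∧ (U : Subgroup π.total) ⊓ π.ker ≤ L ∧ L < π.ker}
  have hinj : Set.InjOn (Subgroup.map (QuotientGroup.mk' (U : Subgroup π.total))) 𝒮 := by
    have key : ∀ L ∈ 𝒮, ((L.map (QuotientGroup.mk' (U : Subgroup π.total))).comap
        (QuotientGroup.mk' (U : Subgroup π.total))) ⊓ π.ker = L := by
      rintro L ⟨-, hUL, hLK⟩
      rw [Subgroup.comap_map_eq, QuotientGroup.ker_mk']
      refine le_antisymm ?_ (le_inf le_sup_left hLK.le)
      rintro x ⟨hx, hxK⟩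
      obtain ⟨a, ha, b, hb, rfl⟩ := Subgroup.mem_sup_of_normal_right.1 hx
      exact mul_mem ha (hUL ⟨hb, (π.ker.mul_mem_cancel_left (hLK.le ha)).1 hxK⟩)
    intro L hL L' hL' h
    rw [← key L hL, ← key L' hL', h]
  have hSfin : 𝒮.Finite := Set.Finite.of_finite_image (Set.toFinite _) hinj
  have hL₀ : (N ⊔ (U : Subgroup π.total)) ⊓ π.ker ∈ 𝒮 :=
    ⟨inferInstance, inf_le_inf_right _ le_sup_right,
      lt_of_le_of_ne inf_le_right fun h => hU (inf_eq_right.1 h)⟩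
  obtain ⟨M, hM, hmax⟩ := hSfin.exists_le_maximal hL₀
  refine ⟨M, ⟨⟨hmax.prop.1, (isClosed_of_open_inf_le π.isClosed_ker U hmax.prop.2.2.le
    hmax.prop.2.1).1, hmax.prop.2.2⟩, fun L hL hML => ?_⟩,
    (le_inf le_sup_left hN.le).trans hM⟩
  -- Maximality within `𝒮` suffices, because every subgroup above `M` also contains `U ⊓ Ker π`.
  exact hmax.le_of_ge ⟨hL.1, hmax.prop.2.1.trans hML, hL.2.2⟩ hML

open Classical in
/-- A coatom that contains an intersection of closed subgroups contains a finite one. -/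
theorem exists_finset_of_iInf_le {ι : Type*} (hM : M ∈ π.coatoms) (N : ι → Subgroup π.total)
    (hN : ∀ i, π.IsSubKernel (N i)) (h : ∀ x ∈ π.ker, (∀ i, x ∈ N i) → x ∈ M) :
    ∃ F : Finset ι, π.ker ⊓ F.inf N ≤ M := by
  obtain ⟨U, hU⟩ := exists_open_inf_le hM
  have hcl := (isClosed_of_open_inf_le π.isClosed_ker U (isSubKernel_of_mem_coatoms hM).le hU).2
  -- `Ker π \ M` is compact because `M` is open in the kernel, and it misses the intersection of all
  -- the `N i`; hence it misses a finite one.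
  obtain ⟨F, hF⟩ := hcl.isCompact.elim_finite_subfamily_closed (fun i => (N i : Set π.total))
    (fun i => (hN i).closed) (by
      rw [Set.eq_empty_iff_forall_notMem]
      rintro x ⟨⟨hx, hxM⟩, hxN⟩
      exact hxM (h x hx (Set.mem_iInter.1 hxN)))
  refine ⟨F, fun x hx => ?_⟩
  by_contra hxM
  have : x ∈ ((π.ker : Set π.total) \ M) ∩ ⋂ i ∈ F, (N i : Set π.total) :=
    ⟨⟨hx.1, hxM⟩, Set.mem_iInter₂.2 ((mem_finset_inf_iff F N).1 hx.2)⟩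
  rw [hF] at this
  exact this

/-- A coatom with non-abelian quotient is prime in the lattice of closed normal subgroups. -/
theorem le_or_le_of_inf_le {A B : Subgroup π.total} (hM : M ∈ π.coatoms)
    (hna : ¬ ∀ x ∈ π.ker, ∀ y ∈ π.ker, x * y * x⁻¹ * y⁻¹ ∈ M) (hA : π.IsSubKernel A)
    (hB : π.IsSubKernel B) (h : A ⊓ B ≤ M) : A ≤ M ∨ B ≤ M := by
  by_contra! hcon
  apply hna
  intro x hx y hy
  have := hA.normal
  have := hB.normal
  have := (isSubKernel_of_mem_coatoms hM).normal
  obtain ⟨a, ha, m, hm, rfl⟩ := exists_mul_of_mem_coatoms hM hA hcon.1 hx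
  obtain ⟨b, hb, n, hn, rfl⟩ := exists_mul_of_mem_coatoms hM hB hcon.2 hy
  -- Modulo `M`, arbitrary elements of the kernel are represented by `a ∈ A` and `b ∈ B`, and `[A,
  -- B] ≤ A ⊓ B ≤ M`. So the quotient would be abelian.
  have hc : a * b * a⁻¹ * b⁻¹ ∈ M := h ⟨by
    have := mul_mem ha (hA.normal.conj_mem _ (inv_mem ha) b)
    simpa [mul_assoc] using this, B.mul_mem (hB.normal.conj_mem _ hb a) (B.inv_mem hb)⟩
  rw [← QuotientGroup.eq_one_iff] at hc hm hn ⊢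
  simpa [hm, hn] using hc

/-- Primality iterated over the finite set. The empty intersection is `Ker π`, which a coatom cannot
contain. -/
theorem exists_le_of_finset_inf_le {ι : Type*} (hM : M ∈ π.coatoms)
    (hna : ¬ ∀ x ∈ π.ker, ∀ y ∈ π.ker, x * y * x⁻¹ * y⁻¹ ∈ M) (F : Finset ι)
    (N : ι → Subgroup π.total) (hN : ∀ i ∈ F, π.IsSubKernel (N i)) (h : π.ker ⊓ F.inf N ≤ M) :
    ∃ i ∈ F, N i ≤ M := by
  classical
  induction F using Finset.induction_on with
  | empty =>
    rw [Finset.inf_empty, inf_top_eq] at h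
    exact absurd (le_antisymm (isSubKernel_of_mem_coatoms hM).le h) (ne_ker_of_mem_coatoms hM)
  | insert j F hj ih =>
    rw [Finset.inf_insert, inf_left_comm] at h
    have hN' := fun i hi => hN i (Finset.mem_insert_of_mem hi)
    rcases le_or_le_of_inf_le hM hna (hN j (Finset.mem_insert_self j F))
      (isSubKernel_finset F N hN') h with h' | h'
    · exact ⟨j, Finset.mem_insert_self j F, h'⟩
    · obtain ⟨i, hi, hiM⟩ := ih hN' h'
      exact ⟨i, Finset.mem_insert_of_mem hi, hiM⟩

end Coatoms

/-! ### Indecomposable covers -/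

section Indecomposable

variable {π : GroupCover.{u, v₁} G} {η : GroupCover.{u, v₂} G}

/-- A quotient of `π` is indecomposable if and only if its kernel is a coatom. -/
theorem isIndecomposable_iff_mem_coatoms (p : OverHom π η) (hp : Function.Surjective p) :
    η.IsIndecomposable ↔ p.kernel ∈ π.coatoms := by
  rw [mem_coatoms_iff]
  constructor
  · rintro ⟨hnb, hind⟩
    have hne : p.kernel ≠ π.ker := by
      intro h
      refine hnb ⟨(injective_iff_map_eq_one η.map).2 fun y hy => ?_, η.surj⟩
      obtain ⟨x, hx, rfl⟩ := p.exists_mem_ker hp (η.mem_ker.2 hy)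
      exact p.mem_kernel.1 (h ▸ hx)
    refine ⟨p.isSubKernel_kernel, hne, fun L hL hpL => ?_⟩
    -- An intermediate `L` yields the factorization of `η` through its quotient by the image of `L`;
    -- the two alternatives of indecomposability become `L = p.kernel` and `L = Ker π`.
    have hN : η.IsSubKernel (L.map (p.hom : π.total →* η.total)) :=
      { normal := hL.normal.map _ hp
        closed := p.isClosedMap _ hL.closed
        le := by
          rintro _ ⟨x, hx, rfl⟩
          exact p.mem_ker_iff.2 (hL.le hx) }
    have hmem : ∀ x, p x ∈ L.map (p.hom : π.total →* η.total) ↔ x ∈ L := by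
      intro x
      refine ⟨?_, fun hx => ⟨x, hx, rfl⟩⟩
      rintro ⟨y, hy, hxy⟩
      have : y⁻¹ * x ∈ p.kernel := by
        rw [p.mem_kernel, p.map_mul, p.map_inv]
        exact inv_mul_eq_one.2 hxy
      simpa using mul_mem hy (hpL this)
    rcases hind (η.quot _ hN) (η.quotHom _ hN).hom (η.quotHom_surjective _ hN)
      (η.quotHom _ hN).comm with h | h
    · refine Or.inl (le_antisymm (fun x hx => ?_) hpL)
      exact (OverHom.injective_iff _).1 h.1 (p x) ((quotHom_eq_one_iff _ _ _).2 ((hmem x).2 hx))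
    · refine Or.inr (le_antisymm hL.le fun x hx => ?_)
      rw [← hmem x, ← quotHom_eq_one_iff _ _ hN]
      apply (injective_iff_map_eq_one (η.quot _ hN).map).1 h.1
      rw [OverHom.comm, p.comm]
      exact hx
  · rintro ⟨-, hne, hmax⟩
    refine ⟨fun hb => hne (le_antisymm p.kernel_le fun x hx => ?_), fun ρ ψ hψ hρ => ?_⟩
    · exact (injective_iff_map_eq_one η.map).1 hb.1 _ ((p.comm x).trans hx)
    -- Conversely, a factorization of `η` is recorded by the kernel of `π.total → ρ.total`, which
    -- lies between `p.kernel` and `Ker π`.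
    · let q : OverHom π ρ := (⟨ψ, hρ⟩ : OverHom η ρ).comp p
      have hq : ∀ x, q x = ψ (p x) := fun _ => rfl
      rcases hmax q.kernel q.isSubKernel_kernel (fun x hx => by
        rw [q.mem_kernel, hq, p.mem_kernel.1 hx, map_one]) with h | h
      · refine Or.inl ⟨(injective_iff_map_eq_one ψ).2 fun y hy => ?_, hψ⟩
        obtain ⟨x, rfl⟩ := hp y
        exact p.mem_kernel.1 (h ▸ (show x ∈ q.kernel from hy))
      · refine Or.inr ⟨(injective_iff_map_eq_one ρ.map).2 fun z hz => ?_, ρ.surj⟩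
        obtain ⟨y, rfl⟩ := hψ z
        obtain ⟨x, rfl⟩ := hp y
        have : x ∈ q.kernel := by
          rw [h, mem_ker, ← p.comm, ← hρ]
          exact hz
        exact this

/-- A cover that is a subdirect fiber product of indecomposable covers is fundamental. -/
theorem isFundamental_of_jointlyInjective {I : Type w} {E : I → GroupCover.{u, v} G}
    (ψ : ∀ i, OverHom π (E i)) (hs : ∀ i, Function.Surjective (ψ i)) (hi : JointlyInjective ψ)
    (hE : ∀ i, (E i).IsIndecomposable) : π.IsFundamental :=
  isFundamental_iff.2 fun x hx h => hi x hx fun i =>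
    h _ ((isIndecomposable_iff_mem_coatoms (ψ i) (hs i)).1 (hE i))

/-- Both covers are tested by the coatom condition on the same subgroup of `π.total`. This avoids
transporting factorizations, whose middle terms are taken in different universes for the two covers.
-/
theorem IsoOver.isIndecomposable (h : π.IsoOver η) (hη : η.IsIndecomposable) :
    π.IsIndecomposable := by
  obtain ⟨p, hp⟩ := h.symm.exists_overHom
  obtain ⟨q, hq⟩ := h.exists_overHom
  have hk : p.kernel = ⊥ := (Subgroup.eq_bot_iff_forall _).2 fun x hx =>
    p.injective_iff.1 hp.1 x hx
  have hid : (OverHom.comp p q).kernel = q.kernel := by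
    ext x
    rw [OverHom.mem_kernel, OverHom.mem_kernel, OverHom.comp_apply]
    exact ⟨fun h => p.injective_iff.1 hp.1 _ h, fun h => by rw [h, p.map_one]⟩
  rw [isIndecomposable_iff_mem_coatoms (OverHom.comp p q) (hp.2.comp hq.2), hid]
  exact (isIndecomposable_iff_mem_coatoms q hq.2).1 hη

/-- If two indices shared a kernel, an element with arbitrary coordinate at one and trivial
coordinate at the other would make that kernel all of `Ker π`. This bounds the size of the index set
by the set of subgroups of `π.total`. -/
theorem JointlySurjective.injective_kernel {I : Type w} {E : I → GroupCover.{u, v} G}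
    {ψ : ∀ i, OverHom π (E i)} (hs : JointlySurjective ψ) (hE : ∀ i, (E i).IsIndecomposable) :
    Function.Injective fun i => (ψ i).kernel := by
  intro i j hij
  by_contra hne
  have hM := (isIndecomposable_iff_mem_coatoms (ψ i) (hs.surjective i)).1 (hE i)
  apply ne_ker_of_mem_coatoms hM
  refine le_antisymm (ψ i).kernel_le fun x hx => ?_
  obtain ⟨z, hz, hzi, hzj⟩ := hs.exists_single i (ψ i x) ((ψ i).mem_ker_iff.2 hx)
  have hzk : z ∈ (ψ i).kernel := by
    change (ψ i).kernel = (ψ j).kernel at hij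
    rw [hij]
    exact hzj j (Ne.symm hne)
  rw [OverHom.mem_kernel, ← hzi]
  exact hzk

end Indecomposable

/-! ### Equivariant homomorphisms from the kernel to a finite simple module -/

section KerHom

variable {π : GroupCover.{u, v₁} G} {η : GroupCover.{u, v₂} G} {A : FiniteSimpleModule G}

/-- The conjugate of an element of the kernel. -/
def conjKer (π : GroupCover.{u, v} G) (h : π.total) (x : π.ker) : π.ker :=
  ⟨h * x * h⁻¹, π.normal_ker.conj_mem x x.2 h⟩

theorem coe_conjKer (h : π.total) (x : π.ker) : (π.conjKer h x : π.total) = h * x * h⁻¹ := rfl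

theorem kerHom_mul (φ : π.kerHom A) (x y : π.ker) : φ.1 (x * y) = φ.1 x + φ.1 y := φ.2.2.1 x y

theorem kerHom_one (φ : π.kerHom A) : φ.1 1 = 0 := by
  have h := kerHom_mul φ 1 1
  rw [mul_one] at h
  exact left_eq_add.1 h

theorem kerHom_inv (φ : π.kerHom A) (x : π.ker) : φ.1 x⁻¹ = -φ.1 x := by
  rw [eq_neg_iff_add_eq_zero, ← kerHom_mul, inv_mul_cancel, kerHom_one]

theorem kerHom_conj (φ : π.kerHom A) (h : π.total) (x : π.ker) :
    φ.1 (π.conjKer h x) = π.map h • φ.1 x :=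
  φ.2.2.2 h x _ rfl

theorem kerHom_eq_iff (φ : π.kerHom A) {x y : π.ker} : φ.1 x = φ.1 y ↔ φ.1 (x⁻¹ * y) = 0 := by
  rw [kerHom_mul, kerHom_inv, neg_add_eq_zero]

theorem kerHom_ne_zero_iff (φ : π.kerHom A) : φ ≠ 0 ↔ ∃ x, φ.1 x ≠ 0 := by
  rw [Ne, ← Subtype.coe_inj, funext_iff, not_forall]
  rfl

/-- The kernel of an equivariant homomorphism. -/
def homKernel (φ : π.kerHom A) : Subgroup π.total where
  carrier := {x | ∃ hx : x ∈ π.ker, φ.1 ⟨x, hx⟩ = 0}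
  mul_mem' := by
    rintro x y ⟨hx, hx0⟩ ⟨hy, hy0⟩
    exact ⟨mul_mem hx hy, (kerHom_mul φ ⟨x, hx⟩ ⟨y, hy⟩).trans (by rw [hx0, hy0, add_zero])⟩
  one_mem' := ⟨one_mem _, kerHom_one φ⟩
  inv_mem' := by
    rintro x ⟨hx, hx0⟩
    exact ⟨inv_mem hx, (kerHom_inv φ ⟨x, hx⟩).trans (by rw [hx0, neg_zero])⟩

theorem coe_mem_homKernel (φ : π.kerHom A) {x : π.ker} :
    (x : π.total) ∈ homKernel φ ↔ φ.1 x = 0 :=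
  ⟨fun h => h.2, fun h => ⟨x.2, h⟩⟩

theorem isSubKernel_homKernel (φ : π.kerHom A) : π.IsSubKernel (homKernel φ) where
  normal := ⟨by
    rintro x ⟨hx, hx0⟩ h
    refine ⟨π.normal_ker.conj_mem x hx h, ?_⟩
    change φ.1 (π.conjKer h ⟨x, hx⟩) = 0
    rw [kerHom_conj, hx0, smul_zero]⟩
  closed := by
    have h : (homKernel φ : Set π.total) = Subtype.val '' (φ.1 ⁻¹' {0}) := by
      ext x
      exact ⟨fun ⟨hx, h⟩ => ⟨⟨x, hx⟩, h, rfl⟩, by rintro ⟨⟨x, hx⟩, h, rfl⟩; exact ⟨hx, h⟩⟩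
    rw [h]
    exact π.isClosed_ker.isClosedEmbedding_subtypeVal.isClosedMap _
      (isClosed_singleton.preimage φ.2.1)
  le := fun _ hx => hx.1

/-- An equivariant homomorphism to a simple module is zero or surjective on each normal
subgroup. -/
theorem exists_mem_kerHom_eq (φ : π.kerHom A) {X : Subgroup π.total} (hX : X.Normal)
    (hne : ∃ x : π.ker, (x : π.total) ∈ X ∧ φ.1 x ≠ 0) (a : A) :
    ∃ x : π.ker, (x : π.total) ∈ X ∧ φ.1 x = a := by
  -- The image of `X ⊓ Ker π` is a `G`-submodule because `X` is normal, so simplicity of `A`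
  -- applies.
  let B : AddSubgroup A :=
    { carrier := {a | ∃ x : π.ker, (x : π.total) ∈ X ∧ φ.1 x = a}
      add_mem' := by
        rintro _ _ ⟨x, hx, rfl⟩ ⟨y, hy, rfl⟩
        exact ⟨x * y, mul_mem hx hy, kerHom_mul φ x y⟩
      zero_mem' := ⟨1, one_mem X, kerHom_one φ⟩
      neg_mem' := by
        rintro _ ⟨x, hx, rfl⟩
        exact ⟨x⁻¹, inv_mem hx, kerHom_inv φ x⟩ }
  rcases A.simple B (by
    rintro g _ ⟨x, hx, rfl⟩
    obtain ⟨h, rfl⟩ := π.surj g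
    exact ⟨π.conjKer h x, hX.conj_mem _ hx h, kerHom_conj φ h x⟩) with h | h
  · obtain ⟨x, hx, hx0⟩ := hne
    have : φ.1 x ∈ B := ⟨x, hx, rfl⟩
    rw [h] at this
    exact absurd this hx0
  · have : a ∈ B := by
      rw [h]
      trivial
    exact this

theorem kerHom_surjective (φ : π.kerHom A) (h : φ ≠ 0) : Function.Surjective φ.1 := fun a => by
  obtain ⟨x, hx⟩ := (kerHom_ne_zero_iff φ).1 h
  obtain ⟨y, -, hy⟩ := exists_mem_kerHom_eq φ π.normal_ker ⟨x, x.2, hx⟩ a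
  exact ⟨y, hy⟩

/-- A normal subgroup on which `φ` does not vanish already maps onto `A`; together with the kernel
of `φ` it generates `Ker π`. -/
theorem homKernel_mem_coatoms (φ : π.kerHom A) (h : φ ≠ 0) : homKernel φ ∈ π.coatoms := by
  rw [mem_coatoms_iff]
  refine ⟨isSubKernel_homKernel φ, fun he => ?_, fun L hL hle => ?_⟩
  · obtain ⟨x, hx⟩ := (kerHom_ne_zero_iff φ).1 h
    exact hx ((coe_mem_homKernel φ).1 (he.ge x.2))
  · by_cases hx : ∃ x : π.ker, (x : π.total) ∈ L ∧ φ.1 x ≠ 0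
    · refine Or.inr (le_antisymm hL.le fun k hk => ?_)
      obtain ⟨y, hy, hyk⟩ := exists_mem_kerHom_eq φ hL.normal hx (φ.1 ⟨k, hk⟩)
      rw [kerHom_eq_iff, ← coe_mem_homKernel] at hyk
      simpa using mul_mem hy (hle hyk)
    · push Not at hx
      exact Or.inl (le_antisymm (fun k hk => ⟨hL.le hk, hx ⟨k, hL.le hk⟩ hk⟩) hle)

/-- Equivariant homomorphisms that vanish on an open subgroup of the kernel are continuous. -/
theorem mem_kerHom_of_open (φ : π.ker → A) (U : OpenNormalSubgroup π.total)
    (hU : ∀ x : π.ker, (x : π.total) ∈ U → φ x = 0) (hmul : ∀ x y, φ (x * y) = φ x + φ y)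
    (hconj : ∀ (h : π.total) (x y : π.ker), (y : π.total) = h * x * h⁻¹ → φ y = π.map h • φ x) :
    φ ∈ π.kerHom A := by
  refine ⟨IsLocallyConstant.continuous ((IsLocallyConstant.iff_exists_open φ).2 fun x => ?_),
    hmul, hconj⟩
  refine ⟨{y | (x⁻¹ * y : π.total) ∈ U}, ?_, ?_, fun y hy => ?_⟩
  · exact U.isOpen'.preimage ((continuous_const_mul _).comp continuous_subtype_val)
  · change ((x : π.total)⁻¹ * x) ∈ U
    rw [inv_mul_cancel]
    exact one_mem U
  · have h := hmul x (x⁻¹ * y)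
    rw [mul_inv_cancel_left, hU (x⁻¹ * y) hy, add_zero] at h
    exact h

/-- The map induced on kernels by a homomorphism over `G`. -/
def OverHom.onKer (p : OverHom π η) (x : π.ker) : η.ker := ⟨p x, p.mem_ker_iff.2 x.2⟩

theorem OverHom.onKer_mul (p : OverHom π η) (x y : π.ker) :
    p.onKer (x * y) = p.onKer x * p.onKer y := Subtype.ext (p.map_mul x y)

theorem OverHom.onKer_eq_one_iff (p : OverHom π η) (x : π.ker) : p.onKer x = 1 ↔ p x = 1 :=
  Subtype.ext_iff

theorem OverHom.onKer_conjKer (p : OverHom π η) (h : π.total) (x : π.ker) :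
    p.onKer (π.conjKer h x) = η.conjKer (p h) (p.onKer x) := by
  apply Subtype.ext
  change p (h * x * h⁻¹) = p h * p x * (p h)⁻¹
  rw [p.map_mul, p.map_mul, p.map_inv]

theorem OverHom.continuous_onKer (p : OverHom π η) : Continuous p.onKer :=
  (p.continuous.comp continuous_subtype_val).subtype_mk _

theorem OverHom.onKer_surjective (p : OverHom π η) (hp : Function.Surjective p) :
    Function.Surjective p.onKer := fun y => by
  obtain ⟨x, hx, hxy⟩ := p.exists_mem_ker hp y.2
  exact ⟨⟨x, hx⟩, Subtype.ext hxy⟩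

/-- Pullback of equivariant homomorphisms. -/
def pullback (p : OverHom π η) (θ : η.kerHom A) : π.kerHom A :=
  ⟨fun x => θ.1 (p.onKer x), θ.2.1.comp p.continuous_onKer,
    fun x y => by
      change θ.1 _ = θ.1 _ + θ.1 _
      rw [p.onKer_mul, kerHom_mul],
    fun h x y hxy => by
      obtain rfl : y = π.conjKer h x := Subtype.ext hxy
      change θ.1 _ = _ • θ.1 _
      rw [p.onKer_conjKer, kerHom_conj, p.comm]⟩

/-- Descent of equivariant homomorphisms along a surjection. -/
theorem exists_descent (p : OverHom π η) (hp : Function.Surjective p) (φ : π.kerHom A)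
    (h : ∀ x, p.onKer x = 1 → φ.1 x = 0) : ∃ θ : η.kerHom A, ∀ x, θ.1 (p.onKer x) = φ.1 x := by
  have hwd : ∀ x y, p.onKer x = p.onKer y → φ.1 x = φ.1 y := by
    intro x y hxy
    rw [kerHom_eq_iff]
    apply h
    apply mul_left_cancel (a := p.onKer x)
    rw [← p.onKer_mul, mul_inv_cancel_left, mul_one, hxy]
  have hs' := p.onKer_surjective hp
  choose s hs using hs'
  have hr : ∀ x, φ.1 (s (p.onKer x)) = φ.1 x := fun x => hwd _ _ (hs _)
  refine ⟨⟨fun y => φ.1 (s y), ?_, fun x y => ?_, fun k x y hxy => ?_⟩, hr⟩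
  · have : CompactSpace π.ker := isCompact_iff_compactSpace.1 π.isClosed_ker.isCompact
    have hq : Topology.IsQuotientMap p.onKer :=
      p.continuous_onKer.isClosedMap.isQuotientMap p.continuous_onKer (p.onKer_surjective hp)
    rw [hq.continuous_iff]
    exact φ.2.1.congr fun x => (hr x).symm
  · rw [← kerHom_mul]
    exact hwd _ _ (by rw [hs, p.onKer_mul, hs, hs])
  · obtain ⟨h, rfl⟩ := hp k
    obtain rfl : y = η.conjKer (p h) x := Subtype.ext hxy
    rw [p.comm, ← kerHom_conj]
    exact hwd _ _ (by rw [hs, p.onKer_conjKer, hs])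

/-- A nonzero equivariant homomorphism induces an isomorphism from the kernel of the quotient cover
to the module. -/
theorem exists_bijective_descent (φ : π.kerHom A) (hφ : φ ≠ 0) :
    ∃ θ : (π.quot (homKernel φ) (isSubKernel_homKernel φ)).kerHom A, Function.Bijective θ.1 ∧
      ∀ x, θ.1 ((π.quotHom (homKernel φ) (isSubKernel_homKernel φ)).onKer x) = φ.1 x := by
  have hN := isSubKernel_homKernel φ
  have hq := (π.quotHom _ hN).onKer_surjective (π.quotHom_surjective _ hN)
  have hone : ∀ x, (π.quotHom _ hN).onKer x = 1 ↔ φ.1 x = 0 := fun x => by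
    rw [OverHom.onKer_eq_one_iff, quotHom_eq_one_iff, coe_mem_homKernel]
  obtain ⟨θ, hθ⟩ := exists_descent (π.quotHom _ hN) (π.quotHom_surjective _ hN) φ
    fun x => (hone x).1
  refine ⟨θ, ⟨fun y y' hyy => ?_, fun a => ?_⟩, hθ⟩
  · rw [kerHom_eq_iff] at hyy
    rw [← inv_mul_eq_one]
    obtain ⟨x, hx⟩ := hq (y⁻¹ * y')
    rw [← hx] at hyy ⊢
    rwa [hone, ← hθ]
  · obtain ⟨x, rfl⟩ := kerHom_surjective φ hφ a
    exact ⟨_, hθ x⟩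

/-- An identification of the quotient kernel with `A` pulls back to `Ker π`, and a nonzero `φ` is
surjective and descends to such an identification. This turns statements about `𝒞_A` into linear
algebra over `F_A`. -/
theorem mem_abSet_iff {N : Subgroup π.total} :
    N ∈ π.abSet A ↔ ∃ φ : π.kerHom A, φ ≠ 0 ∧ homKernel φ = N := by
  constructor
  · rintro ⟨hN, θ, hθ, hb⟩
    have hone : ∀ x : π.ker, (pullback (π.quotHom N hN) ⟨θ, hθ⟩).1 x = 0 ↔ (x : π.total) ∈ N := by
      intro x
      change θ _ = 0 ↔ _
      rw [← kerHom_one (⟨θ, hθ⟩ : (π.quot N hN).kerHom A), hb.1.eq_iff,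
        OverHom.onKer_eq_one_iff, quotHom_eq_one_iff]
    refine ⟨pullback (π.quotHom N hN) ⟨θ, hθ⟩, (kerHom_ne_zero_iff _).2 ?_, ?_⟩
    · obtain ⟨a, ha⟩ := exists_ne (0 : A)
      obtain ⟨y, rfl⟩ := hb.2 a
      obtain ⟨x, rfl⟩ := (π.quotHom N hN).onKer_surjective (π.quotHom_surjective N hN) y
      exact ⟨x, ha⟩
    · ext x
      exact ⟨fun ⟨hx, h⟩ => (hone ⟨x, hx⟩).1 h,
        fun h => ⟨hN.le h, (hone ⟨x, hN.le h⟩).2 h⟩⟩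
  · rintro ⟨φ, hφ, rfl⟩
    obtain ⟨θ, hb, -⟩ := exists_bijective_descent φ hφ
    exact ⟨isSubKernel_homKernel φ, θ.1, θ.2, hb⟩

theorem mem_coatoms_of_mem_abSet {N : Subgroup π.total} (h : N ∈ π.abSet A) : N ∈ π.coatoms := by
  obtain ⟨φ, hφ, rfl⟩ := mem_abSet_iff.1 h
  exact homKernel_mem_coatoms φ hφ

/-- A cover whose kernel is a finite simple module is indecomposable. -/
theorem KerIso.isIndecomposable (h : π.KerIso A) : π.IsIndecomposable := by
  let p : OverHom π π := ⟨ContinuousMonoidHom.id _, fun _ => rfl⟩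
  rw [isIndecomposable_iff_mem_coatoms p Function.surjective_id]
  obtain ⟨φ, hφ, hb⟩ := h
  have hk : homKernel (⟨φ, hφ⟩ : π.kerHom A) = p.kernel := by
    have h1 := kerHom_one (⟨φ, hφ⟩ : π.kerHom A)
    ext x
    refine ⟨fun ⟨hx, h⟩ => ?_, fun h => ?_⟩
    · exact congrArg Subtype.val (hb.1 (h.trans h1.symm))
    · obtain rfl : x = 1 := h
      exact one_mem _
  rw [← hk]
  apply homKernel_mem_coatoms
  rw [kerHom_ne_zero_iff]
  obtain ⟨a, ha⟩ := exists_ne (0 : A)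
  obtain ⟨y, rfl⟩ := hb.2 a
  exact ⟨y, ha⟩

/-- If a finite intersection of coatoms lies in the kernel of a nonzero homomorphism to `A`, then
one of the coatoms is of type `A`. -/
theorem exists_mem_abSet_of_finset {ι : Type*} (F : Finset ι) (N : ι → Subgroup π.total)
    (hN : ∀ i ∈ F, N i ∈ π.coatoms) (φ : π.kerHom A) (hφ : φ ≠ 0)
    (h : π.ker ⊓ F.inf N ≤ homKernel φ) : ∃ i ∈ F, N i ∈ π.abSet A := by
  classical
  induction F using Finset.induction_on with
  | empty =>
    rw [Finset.inf_empty, inf_top_eq] at h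
    exact absurd (le_antisymm (isSubKernel_homKernel φ).le h)
      (ne_ker_of_mem_coatoms (homKernel_mem_coatoms φ hφ))
  | insert j F hj ih =>
    have hN' : ∀ i ∈ F, N i ∈ π.coatoms := fun i hi => hN i (Finset.mem_insert_of_mem hi)
    by_cases hX : π.ker ⊓ F.inf N ≤ homKernel φ
    · obtain ⟨i, hi, hiA⟩ := ih hN' hX
      exact ⟨i, Finset.mem_insert_of_mem hi, hiA⟩
    rw [Finset.inf_insert, inf_left_comm] at h
    set X := π.ker ⊓ F.inf N with hXdef
    have hXs : π.IsSubKernel X :=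
      isSubKernel_finset F N fun i hi => isSubKernel_of_mem_coatoms (hN' i hi)
    have hj' := hN j (Finset.mem_insert_self j F)
    -- If `X ≤ N j`, then `X = N j ⊓ X` would lie in the kernel of `φ`. Hence `X` and the coatom `N
    -- j` generate `Ker π`.
    have hXj : ¬ X ≤ N j := fun hle => hX ((le_inf hle le_rfl).trans h)
    have hdec : ∀ k : π.ker, ∃ x : π.ker, (x : π.total) ∈ X ∧ (x⁻¹ * k : π.total) ∈ N j := by
      intro k
      obtain ⟨x, hx, y, hy, hxy⟩ := exists_mul_of_mem_coatoms hj' hXs hXj k.2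
      refine ⟨⟨x, hXs.le hx⟩, hx, ?_⟩
      rw [← hxy]
      simpa using hy
    -- Since `φ` vanishes on `X ⊓ N j`, the map `k ↦ φ (c k)` is the composite `Ker π → Ker π / N j
    -- ≅ X / (X ⊓ N j) → A`. It is nonzero and kills `N j`, so maximality identifies its kernel with
    -- `N j`.
    choose c hcX hcN using hdec
    have hnj := (isSubKernel_of_mem_coatoms hj').normal
    have hwd : ∀ k x : π.ker, (x : π.total) ∈ X → (x⁻¹ * k : π.total) ∈ N j →
        φ.1 (c k) = φ.1 x := by
      intro k x hx hxk
      rw [kerHom_eq_iff, ← coe_mem_homKernel]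
      refine h ⟨?_, X.mul_mem (X.inv_mem (hcX k)) hx⟩
      have := mul_mem (hcN k) (inv_mem hxk)
      simpa [mul_assoc] using this
    -- The choice `c` carries no continuity; the composite is continuous because it vanishes on the
    -- part of an open subgroup lying in `N j`.
    obtain ⟨U, hU⟩ := exists_open_inf_le hj'
    have hmem : (fun k => φ.1 (c k)) ∈ π.kerHom A := by
      refine mem_kerHom_of_open _ U (fun k hk => ?_) (fun x y => ?_) (fun g x y hxy => ?_)
      · rw [hwd k 1 (one_mem X) (by simpa using hU ⟨hk, k.2⟩), kerHom_one]
      · rw [← kerHom_mul]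
        refine hwd _ _ (mul_mem (hcX x) (hcX y)) ?_
        have := mul_mem (hnj.conj_mem _ (hcN x) ((c y : π.total)⁻¹)) (hcN y)
        simpa [mul_assoc] using this
      · rw [← kerHom_conj]
        refine hwd _ _ (hXs.normal.conj_mem _ (hcX x) g) ?_
        rw [hxy]
        simpa [mul_assoc, coe_conjKer] using hnj.conj_mem _ (hcN x) g
    have hne : (⟨_, hmem⟩ : π.kerHom A) ≠ 0 := by
      rw [kerHom_ne_zero_iff]
      obtain ⟨x, hx, hxφ⟩ := Set.not_subset.1 hX
      refine ⟨⟨x, hXs.le hx⟩, ?_⟩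
      change φ.1 (c _) ≠ 0
      rw [hwd ⟨x, hXs.le hx⟩ ⟨x, hXs.le hx⟩ hx (by simp)]
      exact fun h0 => hxφ ⟨hXs.le hx, h0⟩
    refine ⟨j, Finset.mem_insert_self j F, mem_abSet_iff.2 ⟨_, hne, ?_⟩⟩
    refine (eq_of_le_of_mem_coatoms hj' (homKernel_mem_coatoms _ hne) fun x hx => ?_).symm
    have hxk := (isSubKernel_of_mem_coatoms hj').le hx
    refine ⟨hxk, ?_⟩
    change φ.1 (c _) = 0
    rw [hwd ⟨x, hxk⟩ 1 (one_mem X) (by simpa using hx), kerHom_one]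

theorem mem_inf_homKernel_iff {ι : Type*} (F : Finset ι) (φ : ι → π.kerHom A) (x : π.ker) :
    (x : π.total) ∈ π.ker ⊓ (F.inf fun i => homKernel (φ i)) ↔ ∀ i ∈ F, (φ i).1 x = 0 := by
  rw [Subgroup.mem_inf, mem_finset_inf_iff]
  simp only [coe_mem_homKernel, x.2, true_and]

/-- An equivariant homomorphism that vanishes on the common kernel of finitely many others is a
linear combination of them. -/
theorem mem_span_of_finset {ι : Type*} (F : Finset ι) (φ : ι → π.kerHom A) (ψ : π.kerHom A)
    (h : ∀ x, (∀ i ∈ F, (φ i).1 x = 0) → ψ.1 x = 0) :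
    ψ ∈ Submodule.span A.endRing (φ '' F) := by
  classical
  induction F using Finset.induction_on generalizing ψ with
  | empty =>
    have : ψ = 0 := Subtype.ext (funext fun x => h x (by simp))
    rw [this]
    exact zero_mem _
  | insert j F hj ih =>
    have hmono : Submodule.span A.endRing (φ '' F) ≤
        Submodule.span A.endRing (φ '' (insert j F : Finset ι)) :=
      Submodule.span_mono (Set.image_mono (by simp))
    let X : Subgroup π.total := π.ker ⊓ F.inf fun i => homKernel (φ i)
    have hX : π.IsSubKernel X := isSubKernel_finset F _ fun i _ => isSubKernel_homKernel (φ i)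
    have hXmem : ∀ x : π.ker, (x : π.total) ∈ X ↔ ∀ i ∈ F, (φ i).1 x = 0 := by
      exact mem_inf_homKernel_iff F φ
    by_cases hne : ∃ x : π.ker, (x : π.total) ∈ X ∧ (φ j).1 x ≠ 0
    · choose c hcX hc using exists_mem_kerHom_eq (φ j) hX.normal hne
      have hwd : ∀ x y : π.ker, (x : π.total) ∈ X → (y : π.total) ∈ X →
          (φ j).1 x = (φ j).1 y → ψ.1 x = ψ.1 y := by
        intro x y hx hy hxy
        rw [kerHom_eq_iff] at hxy ⊢
        refine h _ fun i hi => ?_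
        rcases Finset.mem_insert.1 hi with rfl | hi
        · exact hxy
        · exact (hXmem (x⁻¹ * y)).1 (mul_mem (inv_mem hx) hy) i hi
      -- On `X`, the common kernel over `F`, the map `φ j` is onto `A` and `ψ` factors through it.
      -- The factor is a `G`-endomorphism `r` of `A`, and `ψ - r • φ j` vanishes on `X`.
      let r : A.endRing :=
        ⟨{ toFun := fun a => ψ.1 (c a)
           map_zero' := by
            exact (hwd _ 1 (hcX _) (one_mem X) ((hc _).trans (kerHom_one _).symm)).trans
              (kerHom_one ψ)
           map_add' := fun a b => by
            rw [← kerHom_mul]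
            exact hwd _ _ (hcX _) (mul_mem (hcX a) (hcX b)) (by rw [hc, kerHom_mul, hc, hc]) },
          fun g a => by
            obtain ⟨k, rfl⟩ := π.surj g
            change ψ.1 (c _) = _ • ψ.1 (c a)
            rw [← kerHom_conj]
            exact hwd _ _ (hcX _) (hX.normal.conj_mem _ (hcX a) k)
              (by rw [hc, kerHom_conj, hc])⟩
      have hr : ∀ x : π.ker, (x : π.total) ∈ X → ψ.1 x = (r • φ j).1 x := fun x hx =>
        hwd _ _ hx (hcX _) (hc _).symm
      have hsub := ih (ψ - r • φ j) fun x hx => by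
        change ψ.1 x - (r • φ j).1 x = 0
        rw [hr x ((hXmem x).2 hx), sub_self]
      rw [← sub_add_cancel ψ (r • φ j)]
      exact add_mem (hmono hsub) (Submodule.smul_mem _ r
        (Submodule.subset_span ⟨j, by simp, rfl⟩))
    -- Here `φ j` vanishes on `X`, so it imposes no condition beyond those from `F`.
    · push Not at hne
      refine hmono (ih ψ fun x hx => h x fun i hi => ?_)
      rcases Finset.mem_insert.1 hi with rfl | hi
      · exact hne x ((hXmem x).2 hx)
      · exact hx i hi

/-- Linearly independent equivariant homomorphisms are independent as functions. -/
theorem exists_of_linearIndependent {ι : Type*} {φ : ι → π.kerHom A}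
    (hφ : LinearIndependent A.endRing φ) (F : Finset ι) (j : ι) (hj : j ∉ F) (a : A) :
    ∃ x, (φ j).1 x = a ∧ ∀ i ∈ F, (φ i).1 x = 0 := by
  have := A.isField_endRing.nontrivial
  let X : Subgroup π.total := π.ker ⊓ F.inf fun i => homKernel (φ i)
  have hX : π.IsSubKernel X := isSubKernel_finset F _ fun i _ => isSubKernel_homKernel (φ i)
  have hXmem : ∀ x : π.ker, (x : π.total) ∈ X ↔ ∀ i ∈ F, (φ i).1 x = 0 :=
    mem_inf_homKernel_iff F φ
  -- If `φ j` vanished on the common kernel `X`, it would be a combination of the `φ i` with `i ∈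
  -- F`, against independence; simplicity of `A` then gives every value.
  obtain ⟨x, hx, hxa⟩ := exists_mem_kerHom_eq (φ j) hX.normal (by
    by_contra! hcon
    exact hφ.notMem_span_image (s := (F : Set ι)) (by simpa using hj)
      (mem_span_of_finset F φ (φ j) fun x hx => hcon x ((hXmem x).2 hx))) a
  exact ⟨x, hxa, (hXmem x).1 hx⟩

end KerHom

/-! ### Abelian minimal kernels are finite simple modules -/

/-- A coatom is open in the kernel, so some open normal `U` meets the kernel trivially and the
kernel embeds into the finite group of cosets of `U`. -/
theorem finite_of_bot_mem_coatoms {σ : GroupCover.{u, v} G} (h : ⊥ ∈ σ.coatoms) :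
    Finite σ.ker := by
  obtain ⟨U, hU⟩ := exists_open_inf_le h
  have hfin : Finite (σ.total ⧸ (U : Subgroup σ.total)) :=
    inferInstanceAs (Finite (σ.total ⧸ U.toOpenSubgroup.toSubgroup))
  refine Finite.of_injective
    (fun x : σ.ker => (QuotientGroup.mk (x : σ.total) : σ.total ⧸ (U : Subgroup σ.total)))
    fun x y hxy => ?_
  have h1 : (x⁻¹ * y : σ.total) ∈ (⊥ : Subgroup σ.total) :=
    hU ⟨QuotientGroup.eq.1 hxy, σ.ker.mul_mem (σ.ker.inv_mem x.2) y.2⟩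
  exact Subtype.ext (inv_mul_eq_one.1 h1)

/-- The trivial subgroup is a coatom, so the kernel is finite. Conjugation makes it a `G`-module
because it is abelian, and its submodules are exactly the closed normal subgroups below the kernel,
so it is simple. -/
theorem exists_kerIso (σ : GroupCover.{u, u} G) (hind : σ.IsIndecomposable)
    (hab : σ.HasAbelianKer) : ∃ A : FiniteSimpleModule G, σ.KerIso A := by
  have hbot : ⊥ ∈ σ.coatoms := by
    have h := (isIndecomposable_iff_mem_coatoms (π := σ) (η := σ)
      ⟨ContinuousMonoidHom.id _, fun _ => rfl⟩ Function.surjective_id).1 hind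
    convert h
    exact (Subgroup.ext fun x => Iff.rfl)
  have hfin := finite_of_bot_mem_coatoms hbot
  obtain ⟨s, hsc, hs⟩ := σ.exists_section
  -- Lifts of the same element of `G` differ by an element of the abelian kernel, so they conjugate
  -- the kernel alike. The action defined through the section `s` is thus independent of `s`, while
  -- continuity of `s` makes the action continuous.
  have hconj : ∀ h h', σ.map h = σ.map h' → ∀ x, σ.conjKer h x = σ.conjKer h' x := by
    intro h h' hh x
    apply Subtype.ext
    have hk : h'⁻¹ * h ∈ σ.ker := by
      rw [mem_ker, map_mul, map_inv, hh, inv_mul_cancel]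
    have := hab _ hk x x.2
    rw [coe_conjKer, coe_conjKer]
    calc h * x * h⁻¹ = h' * (h'⁻¹ * h * x) * h⁻¹ := by group
      _ = h' * x * h'⁻¹ := by rw [this]; group
  let _ : CommGroup σ.ker := { mul_comm := fun x y => Subtype.ext (hab x x.2 y y.2) }
  let _ : DistribMulAction G (Additive σ.ker) :=
    { smul := fun g x => Additive.ofMul (σ.conjKer (s g) x.toMul)
      one_smul := fun x => by
        change Additive.ofMul (σ.conjKer (s 1) x.toMul) = x
        rw [hconj (s 1) 1 (by rw [hs, map_one])]
        apply Additive.toMul.injective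
        exact Subtype.ext (by simp [coe_conjKer])
      mul_smul := fun g g' x => by
        change Additive.ofMul (σ.conjKer (s (g * g')) x.toMul) =
          Additive.ofMul (σ.conjKer (s g) (σ.conjKer (s g') x.toMul))
        rw [hconj (s (g * g')) (s g * s g') (by rw [map_mul, hs, hs, hs])]
        apply Additive.toMul.injective
        exact Subtype.ext (by simp [coe_conjKer, mul_assoc])
      smul_zero := fun g => by
        apply Additive.toMul.injective
        exact Subtype.ext (by
          change s g * 1 * (s g)⁻¹ = 1
          simp)
      smul_add := fun g x y => by
        apply Additive.toMul.injective
        exact Subtype.ext (by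
          change s g * (x.toMul * y.toMul) * (s g)⁻¹ =
            s g * x.toMul * (s g)⁻¹ * (s g * y.toMul * (s g)⁻¹)
          group) }
  have hsmul : ∀ (h : σ.total) (x : σ.ker),
      σ.map h • Additive.ofMul x = Additive.ofMul (σ.conjKer h x) := fun h x =>
    congrArg Additive.ofMul (hconj _ _ (hs _) x)
  have hcs : ContinuousSMul G (Additive σ.ker) := ⟨by
    change Continuous fun q : G × σ.ker => σ.conjKer (s q.1) q.2
    unfold conjKer
    fun_prop⟩
  have hdisc : DiscreteTopology (Additive σ.ker) := inferInstanceAs (DiscreteTopology σ.ker)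
  have hnt : Nontrivial (Additive σ.ker) := by
    have h : Nontrivial σ.ker :=
      (Subgroup.nontrivial_iff_ne_bot _).2 (ne_ker_of_mem_coatoms hbot).symm
    exact h
  have hsimple : ∀ B : AddSubgroup (Additive σ.ker), (∀ (g : G), ∀ b ∈ B, g • b ∈ B) →
      B = ⊥ ∨ B = ⊤ := by
    intro B hB
    let L : Subgroup σ.total :=
      { carrier := {x | ∃ y : σ.ker, Additive.ofMul y ∈ B ∧ (y : σ.total) = x}
        mul_mem' := by
          rintro _ _ ⟨x, hx, rfl⟩ ⟨y, hy, rfl⟩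
          exact ⟨x * y, B.add_mem hx hy, rfl⟩
        one_mem' := ⟨1, B.zero_mem, rfl⟩
        inv_mem' := by
          rintro _ ⟨x, hx, rfl⟩
          exact ⟨x⁻¹, B.neg_mem hx, rfl⟩ }
    have hLB : ∀ y : σ.ker, (y : σ.total) ∈ L ↔ Additive.ofMul y ∈ B := fun y =>
      ⟨fun ⟨y', hy', h⟩ => Subtype.ext h ▸ hy', fun h => ⟨y, h, rfl⟩⟩
    have hL : σ.IsSubKernel L :=
      { normal := ⟨by
          rintro _ ⟨x, hx, rfl⟩ h
          refine ⟨σ.conjKer h x, ?_, rfl⟩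
          rw [← hsmul]
          exact hB _ _ hx⟩
        closed := by
          refine Set.Finite.isClosed (Set.Finite.subset (Set.finite_range
            (Subtype.val : σ.ker → σ.total)) ?_)
          rintro _ ⟨y, -, rfl⟩
          exact ⟨y, rfl⟩
        le := by
          rintro _ ⟨y, -, rfl⟩
          exact y.2 }
    rcases eq_or_eq_of_mem_coatoms hbot hL bot_le with h | h
    · refine Or.inl ((AddSubgroup.eq_bot_iff_forall B).2 fun y hy => ?_)
      have hy' := (hLB y.toMul).2 hy
      rw [h, Subgroup.mem_bot] at hy'
      exact congrArg Additive.ofMul (Subtype.ext hy' : y.toMul = 1)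
    · exact Or.inr ((AddSubgroup.eq_top_iff' B).2 fun y =>
        (hLB y.toMul).1 (h.ge y.toMul.2))
  refine ⟨{ carrier := Additive σ.ker, simple := hsimple }, Additive.ofMul,
    ⟨continuous_id, fun _ _ => rfl, fun h x y hxy => ?_⟩, Additive.ofMul.bijective⟩
  obtain rfl : y = σ.conjKer h x := Subtype.ext hxy
  exact (hsmul h x).symm

/-! ### Comparison of extension classes -/

section Classes

variable {σ : GroupCover.{u, v₁} G} {η : GroupCover.{u, v₂} G} {A : FiniteSimpleModule G}

/-- Equality of cohomology classes in terms of factor sets. -/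
theorem exists_cochain_of_classMap_eq (φ : σ.kerHom A) (θ : η.kerHom A)
    (h : σ.classMap A φ = η.classMap A θ) (s : G → σ.total) (hs : σ.IsSection s)
    (t : G → η.total) (ht : η.IsSection t) :
    ∃ k : G → A, Continuous k ∧ ∀ a b,
      φ.1 (σ.factorSet s hs (a, b)) - θ.1 (η.factorSet t ht (a, b)) =
      a • k b - k (a * b) + k a := by
  rw [classMap_eq _ _ _ s hs, classMap_eq _ _ _ t ht, Submodule.Quotient.eq] at h
  exact h

/-- An equality of extension classes is induced by a homomorphism over `G`. -/
theorem exists_overHom_of_classMap_eq (φ : σ.kerHom A) (θ : η.kerHom A)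
    (hθ : Function.Bijective θ.1) (h : σ.classMap A φ = η.classMap A θ) :
    ∃ ψ : OverHom σ η, ∀ x, θ.1 (ψ.onKer x) = φ.1 x := by
  obtain ⟨s, hs⟩ := σ.exists_section
  obtain ⟨t, ht⟩ := η.exists_section
  obtain ⟨k, hk, hks⟩ := exists_cochain_of_classMap_eq φ θ h s hs t ht
  let θ' : A → η.ker := (Equiv.ofBijective θ.1 hθ).symm
  have hθ' : ∀ a, θ.1 (θ' a) = a := (Equiv.ofBijective θ.1 hθ).apply_symm_apply
  have hκ : ∀ x, x * (s (σ.map x))⁻¹ ∈ σ.ker := fun x => by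
    rw [mem_ker, map_mul, map_inv, hs.2, mul_inv_cancel]
  let κ : σ.total → σ.ker := fun x => ⟨x * (s (σ.map x))⁻¹, hκ x⟩
  have hκc : Continuous κ := by
    have h1 := hs.1.comp σ.map.continuous_toFun
    exact (continuous_id.mul h1.inv).subtype_mk _
  -- Writing `x = κ(x) s(σ x)`, the homomorphism sought is `x ↦ m(x) t(σ x)`, where `m` is `φ ∘ κ`
  -- corrected by the cochain `k` and carried back by `θ`. The coboundary relation is exactly what
  -- makes it multiplicative.
  let m : σ.total → η.ker := fun x => θ' (φ.1 (κ x) + k (σ.map x))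
  have hm : ∀ x, θ.1 (m x) = φ.1 (κ x) + k (σ.map x) := fun x => hθ' _
  have hmc : Continuous m := continuous_of_discreteTopology.comp
    ((φ.2.1.comp hκc).add (hk.comp σ.map.continuous_toFun))
  have hκmul : ∀ x y, κ (x * y) =
      κ x * σ.conjKer (s (σ.map x)) (κ y) * σ.factorSet s hs (σ.map x, σ.map y) := by
    intro x y
    apply Subtype.ext
    change x * y * (s (σ.map (x * y)))⁻¹ = x * (s (σ.map x))⁻¹ *
      (s (σ.map x) * (y * (s (σ.map y))⁻¹) * (s (σ.map x))⁻¹) *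
      (s (σ.map x) * s (σ.map y) * (s (σ.map x * σ.map y))⁻¹)
    rw [map_mul]
    group
  have hmmul : ∀ x y, m (x * y) =
      m x * η.conjKer (t (σ.map x)) (m y) * η.factorSet t ht (σ.map x, σ.map y) := by
    intro x y
    apply hθ.1
    have h1 := hks (σ.map x) (σ.map y)
    rw [sub_eq_iff_eq_add] at h1
    rw [kerHom_mul, kerHom_mul, kerHom_conj, hm, hm, hm, hκmul, kerHom_mul, kerHom_mul,
      kerHom_conj, hs.2, ht.2, map_mul, h1, smul_add]
    abel
  let ψ : OverHom σ η :=
    { hom :=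
        { toMonoidHom := MonoidHom.mk' (fun x => (m x : η.total) * t (σ.map x)) fun x y => by
            rw [hmmul, map_mul]
            simp only [Subgroup.coe_mul, coe_conjKer, factorSet]
            group
          continuous_toFun := (continuous_subtype_val.comp hmc).mul
            (ht.1.comp σ.map.continuous_toFun) }
      comm := fun x => by
        change η.map ((m x : η.total) * t (σ.map x)) = σ.map x
        rw [map_mul, ht.2, η.mem_ker.1 (m x).2, one_mul] }
  refine ⟨ψ, fun x => ?_⟩
  have hx : σ.map x = 1 := x.2
  -- The sections are not normalized, so `s 1` and `t 1` enter on the kernel. The coboundary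
  -- relation at `(1, 1)` reads `φ(s 1) - θ(t 1) = k 1` and cancels them.
  have h1 := hks 1 1
  have hs1 : s 1 ∈ σ.ker := hs.2 1
  have ht1 : t 1 ∈ η.ker := ht.2 1
  have e1 : σ.factorSet s hs (1, 1) = ⟨s 1, hs1⟩ := Subtype.ext (by simp [factorSet])
  have e2 : η.factorSet t ht (1, 1) = ⟨t 1, ht1⟩ := Subtype.ext (by simp [factorSet])
  rw [e1, e2, one_smul, mul_one, sub_self, zero_add, sub_eq_iff_eq_add] at h1
  have e3 : ψ.onKer x = m x * ⟨t 1, ht1⟩ := Subtype.ext (by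
    change (m x : η.total) * t (σ.map x) = m x * t 1
    rw [hx])
  have e4 : κ x = x * (⟨s 1, hs1⟩ : σ.ker)⁻¹ := Subtype.ext (by
    change (x : σ.total) * (s (σ.map x))⁻¹ = x * (s 1)⁻¹
    rw [hx])
  rw [e3, kerHom_mul, hm, e4, kerHom_mul, kerHom_inv, hx, h1]
  abel

/-- For a section `s` of `σ`, the map `p ∘ s` is a section of `η` whose factor set is the image of
that of `s`; with these choices the two cocycles coincide. -/
theorem classMap_pullback (p : OverHom σ η) (θ : η.kerHom A) :
    σ.classMap A (pullback p θ) = η.classMap A θ := by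
  obtain ⟨s, hs⟩ := σ.exists_section
  have ht : η.IsSection fun g => p (s g) :=
    ⟨p.continuous.comp hs.1, fun g => by rw [p.comm, hs.2]⟩
  rw [classMap_eq _ _ _ s hs, classMap_eq _ _ _ _ ht]
  congr 1
  refine Subtype.ext (funext fun q => congrArg θ.1 (Subtype.ext ?_))
  change p (s q.1 * s q.2 * (s (q.1 * q.2))⁻¹) = p (s q.1) * p (s q.2) * (p (s (q.1 * q.2)))⁻¹
  rw [p.map_mul, p.map_mul, p.map_inv]

/-- The quotient by the kernel of a nonzero homomorphism `φ` is an extension of class `φ_* f`. -/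
theorem isExtensionOfClass_quot (φ : σ.kerHom A) (hφ : φ ≠ 0) :
    (σ.quot (homKernel φ) (isSubKernel_homKernel φ)).IsExtensionOfClass A (σ.classMap A φ) := by
  obtain ⟨θ, hb, hθ⟩ := exists_bijective_descent φ hφ
  refine ⟨θ, hb, ?_⟩
  rw [← classMap_pullback (σ.quotHom _ (isSubKernel_homKernel φ)) θ]
  congr 1
  exact Subtype.ext (funext hθ)

theorem IsExtensionOfClass.kerIso {c : A.H2} (h : η.IsExtensionOfClass A c) : η.KerIso A := by
  obtain ⟨φ, hφ, -⟩ := h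
  exact ⟨φ.1, φ.2, hφ⟩

/-- A cover whose kernel embeds into a power of `A` is the fiber product of the extensions by `A`
corresponding to a basis of the dual of its kernel. -/
theorem isoOver_fiberProduct_of_basis (hσ : ∀ x, (∀ φ : σ.kerHom A, φ.1 x = 0) → x = 1)
    {I : Type w} (φ : Module.Basis I A.endRing (σ.kerHom A)) (E : I → GroupCover.{u, v} G)
    (hE : ∀ i, (E i).IsExtensionOfClass A (σ.classMap A (φ i))) :
    σ.IsoOver (fiberProduct E) := by
  choose θ hθ hc using hE
  choose ψ hψ using fun i => exists_overHom_of_classMap_eq (φ i) (θ i) (hθ i) (hc i).symm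
  have hψ1 : ∀ i x, (ψ i) x.1 = 1 ↔ (φ i).1 x = 0 := fun i x => by
    rw [← OverHom.onKer_eq_one_iff, ← hψ, ← kerHom_one (θ i), (hθ i).1.eq_iff]
  refine isoOver_fiberProduct ψ (jointlySurjective_of_finset ψ fun F j hj y hy => ?_)
    fun x hx h => ?_
  -- Linear independence of the basis gives joint surjectivity.
  · obtain ⟨x, hx, hxF⟩ := exists_of_linearIndependent φ.linearIndependent F j hj
      ((θ j).1 ⟨y, hy⟩)
    rw [← hψ] at hx
    exact ⟨x, x.2, congrArg Subtype.val ((hθ j).1 hx), fun i hi => (hψ1 i x).2 (hxF i hi)⟩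
  · refine congrArg Subtype.val (hσ ⟨x, hx⟩ fun χ => ?_)
    -- Spanning gives joint injectivity: an element killed by all `φ i` is killed by the whole dual,
    -- which separates points by `hσ`.
    have hχ : χ ∈ Submodule.span A.endRing (Set.range φ) := by
      rw [φ.span_eq]
      trivial
    induction hχ using Submodule.span_induction with
    | mem χ h' =>
      obtain ⟨i, rfl⟩ := h'
      exact (hψ1 i ⟨x, hx⟩).1 (h i)
    | zero => rfl
    | add a b _ _ ha hb =>
      change a.1 _ + b.1 _ = 0
      rw [ha, hb, add_zero]
    | smul r a _ ha =>
      change r • a.1 _ = 0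
      rw [ha, smul_zero]

end Classes

/-- Each member of `𝒞_A` is the kernel of a homomorphism to `A` that vanishes on `N_A` and so
descends to `B_A`. An element killed by all of these lifts into every member of `𝒞_A`, that is, into
`N_A`. -/
theorem abPart_separated (π : GroupCover.{u, v} G) (A : FiniteSimpleModule G)
    (x : (π.abPart A).ker) (hx : ∀ φ : (π.abPart A).kerHom A, φ.1 x = 0) : x = 1 := by
  have hN := π.isSubKernel_inter (π.abSet A) fun _ hN => hN.1
  change (π.quot _ hN).ker at x
  change ∀ φ : (π.quot _ hN).kerHom A, φ.1 x = 0 at hx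
  change x = (1 : (π.quot _ hN).ker)
  have hq := π.quotHom_surjective _ hN
  obtain ⟨z, rfl⟩ := (π.quotHom _ hN).onKer_surjective hq x
  rw [OverHom.onKer_eq_one_iff, quotHom_eq_one_iff]
  refine ⟨z.2, Subgroup.mem_sInf.2 fun N hNA => ?_⟩
  obtain ⟨φ, -, rfl⟩ := mem_abSet_iff.1 hNA
  obtain ⟨θ, hθ⟩ := exists_descent (π.quotHom _ hN) hq φ fun y hy => by
    rw [OverHom.onKer_eq_one_iff, quotHom_eq_one_iff] at hy
    exact (coe_mem_homKernel φ).1 (Subgroup.mem_sInf.1 hy.2 _ hNA)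
  rw [coe_mem_homKernel, ← hθ]
  exact hx θ

/-! ### Fiber products of quotients -/

section Coatoms

variable {π : GroupCover.{u, v₁} G} {ζ : GroupCover.{u, v₂} G}

/-- A family of surjections is jointly surjective if no coatom contains both the kernel of a
member and the intersection of the kernels of finitely many other members. -/
theorem jointlySurjective_of_coatoms {I : Type w} {E : I → GroupCover.{u, v} G}
    (ψ : ∀ i, OverHom π (E i)) (hψ : ∀ i, Function.Surjective (ψ i))
    (h : ∀ (F : Finset I) (j : I), j ∉ F → ∀ M ∈ π.coatoms, (ψ j).kernel ≤ M →
      ¬ π.ker ⊓ (F.inf fun i => (ψ i).kernel) ≤ M) : JointlySurjective ψ := by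
  refine jointlySurjective_of_finset ψ fun F j hj y hy => ?_
  obtain ⟨k, hk, rfl⟩ := (ψ j).exists_mem_ker (hψ j) hy
  have hX := isSubKernel_finset F (fun i => (ψ i).kernel) fun i _ => (ψ i).isSubKernel_kernel
  have hs := hX.sup (ψ j).isSubKernel_kernel
  -- The subgroup generated is closed and normal; were it proper, a coatom above it would contradict
  -- `h`. Splitting `k` along it gives the required single-coordinate element.
  have htop : π.ker ⊓ (F.inf fun i => (ψ i).kernel) ⊔ (ψ j).kernel = π.ker := by
    by_contra hne
    obtain ⟨M, hM, hle⟩ := hs.exists_le_coatom hne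
    exact h F j hj M hM (le_sup_right.trans hle) (le_sup_left.trans hle)
  rw [← htop, (ψ j).isSubKernel_kernel.mem_sup_iff] at hk
  obtain ⟨x, hx, m, hm, rfl⟩ := hk
  refine ⟨x, hx.1, ?_, fun i hi => (mem_finset_inf_iff F _).1 hx.2 i hi⟩
  rw [(ψ j).map_mul, (ψ j).mem_kernel.1 hm, mul_one]

theorem mem_naSet_iff {N : Subgroup π.total} :
    N ∈ π.naSet ζ ↔ ∃ p : OverHom π ζ, Function.Surjective p ∧ p.kernel = N := by
  constructor
  · rintro ⟨hN, hiso⟩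
    obtain ⟨q, hq⟩ := hiso.exists_overHom
    refine ⟨q.comp (π.quotHom N hN), hq.2.comp (π.quotHom_surjective N hN), ?_⟩
    ext x
    rw [OverHom.mem_kernel, OverHom.comp_apply, ← quotHom_eq_one_iff π N hN]
    exact ⟨fun h => q.injective_iff.1 hq.1 _ h, fun h => by rw [h, q.map_one]⟩
  · rintro ⟨p, hp, rfl⟩
    exact ⟨p.isSubKernel_kernel, quot_isoOver_of_kernel_eq p hp _ _ rfl⟩

theorem hasAbelianKer_iff (p : OverHom π ζ) (hp : Function.Surjective p) :
    ζ.HasAbelianKer ↔ ∀ x ∈ π.ker, ∀ y ∈ π.ker, x * y * x⁻¹ * y⁻¹ ∈ p.kernel := by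
  have key : ∀ x y, x * y * x⁻¹ * y⁻¹ ∈ p.kernel ↔ p x * p y = p y * p x := fun x y => by
    rw [p.mem_kernel, p.map_mul, p.map_mul, p.map_mul, p.map_inv, p.map_inv, mul_inv_eq_one,
      mul_inv_eq_iff_eq_mul]
  constructor
  · intro h x hx y hy
    exact (key x y).2 (h _ (p.mem_ker_iff.2 hx) _ (p.mem_ker_iff.2 hy))
  · intro h x hx y hy
    obtain ⟨x, hx', rfl⟩ := p.exists_mem_ker hp hx
    obtain ⟨y, hy', rfl⟩ := p.exists_mem_ker hp hy
    exact (key x y).1 (h x hx' y hy')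

theorem mem_coatoms_of_mem_naSet (hζ : ζ.IsIndecomposable) {N : Subgroup π.total}
    (h : N ∈ π.naSet ζ) : N ∈ π.coatoms := by
  obtain ⟨p, hp, rfl⟩ := mem_naSet_iff.1 h
  exact (isIndecomposable_iff_mem_coatoms p hp).1 hζ

theorem not_commutator_of_mem_naSet (hζ : ¬ ζ.HasAbelianKer) {N : Subgroup π.total}
    (h : N ∈ π.naSet ζ) : ¬ ∀ x ∈ π.ker, ∀ y ∈ π.ker, x * y * x⁻¹ * y⁻¹ ∈ N := by
  obtain ⟨p, hp, rfl⟩ := mem_naSet_iff.1 h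
  rwa [← hasAbelianKer_iff p hp]

/-- The `ζ`-isotypic part, for an indecomposable cover `ζ` with non-abelian kernel, is a fiber
product of copies of `ζ`. -/
theorem naPart_isoOver_fiberProduct (hζ : ζ.IsIndecomposable) (hna : ¬ ζ.HasAbelianKer)
    {I : Type w} (E : I → GroupCover.{u, v} G) (e : I ≃ π.naSet ζ)
    (hE : ∀ i, (E i).IsoOver ζ) : (π.naPart ζ).IsoOver (fiberProduct E) := by
  have hmem : ∀ i, (e i : Subgroup π.total) ∈ π.naSet (E i) := fun i => by
    obtain ⟨hN, hiso⟩ := (e i).2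
    exact ⟨hN, hiso.trans (hE i).symm⟩
  choose ψ hψ hker using fun i => mem_naSet_iff.1 (hmem i)
  have hco : ∀ i, (e i : Subgroup π.total) ∈ π.coatoms := fun i =>
    mem_coatoms_of_mem_naSet hζ (e i).2
  refine quot_isoOver_fiberProduct ψ (jointlySurjective_of_coatoms ψ hψ
    fun F j hj M hM hjM hFM => ?_) _ _ fun x hx => ?_
  · rw [hker] at hjM
    obtain rfl := eq_of_le_of_mem_coatoms (hco j) hM hjM
    -- By primality some member indexed by `F` is contained in the `j`-th; two coatoms in this
    -- relation are equal, so `i = j` because `e` is injective.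
    obtain ⟨i, hi, hle⟩ := exists_le_of_finset_inf_le (hco j)
      (not_commutator_of_mem_naSet hna (e j).2) F _
      (fun i _ => (ψ i).isSubKernel_kernel) hFM
    rw [hker] at hle
    have := e.injective (Subtype.ext (eq_of_le_of_mem_coatoms (hco i) (hco j) hle))
    exact hj (this ▸ hi)
  · rw [Subgroup.mem_inf, Subgroup.mem_sInf]
    constructor
    · intro h i
      rw [← OverHom.mem_kernel, hker]
      exact h.2 _ (e i).2
    · refine fun h => ⟨hx, fun N hN => ?_⟩
      obtain ⟨i, hi⟩ := e.surjective ⟨N, hN⟩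
      have := (ψ i).mem_kernel.2 (h i)
      rwa [hker, hi] at this

end Coatoms

/-! ### The isotypic decomposition -/

section Isotypic

/-- `𝒞_λ` for `λ` in `Λ(G)`. -/
def isotypicSet (π : GroupCover.{u, v} G) : LambdaNa G ⊕ LambdaAb G → Set (Subgroup π.total)
  | Sum.inl ζ => π.naSet ζ.rep
  | Sum.inr A => π.abSet A.rep

variable {π : GroupCover.{u, v} G}

theorem rep_isIndecomposable (ζ : LambdaNa G) : ζ.rep.IsIndecomposable := (Quotient.out ζ).2.1

theorem not_hasAbelianKer_rep (ζ : LambdaNa G) : ¬ ζ.rep.HasAbelianKer := (Quotient.out ζ).2.2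

theorem KerIso.congr {A B : FiniteSimpleModule G} (hAB : A ≈ B) (h : π.KerIso A) :
    π.KerIso B := by
  obtain ⟨e, he⟩ := hAB
  obtain ⟨φ, hφ, hb⟩ := h
  refine ⟨fun x => e (φ x), ⟨continuous_of_discreteTopology.comp hφ.1, fun x y => ?_,
    fun h x y hxy => ?_⟩, e.bijective.comp hb⟩
  · change e (φ _) = e (φ _) + e (φ _)
    rw [hφ.2.1, map_add]
  · change e (φ _) = _ • e (φ _)
    rw [hφ.2.2 h x y hxy, he]

theorem KerIso.equiv {A B : FiniteSimpleModule G} (hA : π.KerIso A) (hB : π.KerIso B) :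
    A ≈ B := by
  obtain ⟨φ, hφ, hb⟩ := hA
  obtain ⟨θ, hθ, hb'⟩ := hB
  let c : A → π.ker := (Equiv.ofBijective φ hb).symm
  have hc : ∀ a, φ (c a) = a := (Equiv.ofBijective φ hb).apply_symm_apply
  have hc' : Function.Bijective c := (Equiv.ofBijective φ hb).symm.bijective
  have hadd : ∀ a b, c (a + b) = c a * c b := fun a b => hb.1 (by rw [hφ.2.1, hc, hc, hc])
  refine ⟨AddEquiv.ofBijective (AddMonoidHom.mk' (fun a => θ (c a)) fun a b => ?_)
    (hb'.comp hc'), fun g a => ?_⟩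
  · rw [hadd, hθ.2.1]
  · obtain ⟨h, rfl⟩ := π.surj g
    have hconj : c (π.map h • a) = π.conjKer h (c a) :=
      hb.1 (by rw [hφ.2.2 h (c a) (π.conjKer h (c a)) rfl, hc, hc])
    change θ (c _) = _ • θ (c a)
    rw [hconj, hθ.2.2 h (c a) (π.conjKer h (c a)) rfl]

theorem mem_coatoms_of_mem_isotypicSet {t : LambdaNa G ⊕ LambdaAb G} {N : Subgroup π.total}
    (h : N ∈ π.isotypicSet t) : N ∈ π.coatoms := by
  rcases t with ζ | A
  · exact mem_coatoms_of_mem_naSet (rep_isIndecomposable ζ) h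
  · exact mem_coatoms_of_mem_abSet h

theorem commutator_mem_of_mem_abSet {A : FiniteSimpleModule G} {N : Subgroup π.total}
    (h : N ∈ π.abSet A) : ∀ x ∈ π.ker, ∀ y ∈ π.ker, x * y * x⁻¹ * y⁻¹ ∈ N := by
  obtain ⟨φ, -, rfl⟩ := mem_abSet_iff.1 h
  intro x hx y hy
  lift x to π.ker using hx
  lift y to π.ker using hy
  rw [← Subgroup.coe_inv, ← Subgroup.coe_inv, ← Subgroup.coe_mul, ← Subgroup.coe_mul,
    ← Subgroup.coe_mul, coe_mem_homKernel]
  rw [kerHom_mul, kerHom_mul, kerHom_mul, kerHom_inv, kerHom_inv]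
  abel

/-- Commutativity of the quotient kernel separates the abelian from the non-abelian types; within
each kind, the quotient determines the isomorphism class and hence the chosen representative. -/
theorem isotypicSet_unique {t t' : LambdaNa G ⊕ LambdaAb G} {N : Subgroup π.total}
    (h : N ∈ π.isotypicSet t) (h' : N ∈ π.isotypicSet t') : t = t' := by
  rcases t with ζ | A <;> rcases t' with ζ' | A'
  · obtain ⟨hN, hiso⟩ := h
    obtain ⟨hN', hiso'⟩ := h'
    exact congrArg Sum.inl (Quotient.out_equiv_out.1 (hiso.symm.trans hiso'))
  · exact absurd (commutator_mem_of_mem_abSet h')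
      (not_commutator_of_mem_naSet (not_hasAbelianKer_rep ζ) h)
  · exact absurd (commutator_mem_of_mem_abSet h)
      (not_commutator_of_mem_naSet (not_hasAbelianKer_rep ζ') h')
  · obtain ⟨hN, hiso⟩ := h
    obtain ⟨hN', hiso'⟩ := h'
    exact congrArg Sum.inr (Quotient.out_equiv_out.1 (hiso.equiv hiso'))

theorem mem_isotypicSet_of_mem_abSet {A : FiniteSimpleModule G} {N : Subgroup π.total}
    (h : N ∈ π.abSet A) : N ∈ π.isotypicSet (Sum.inr ⟦A⟧) := by
  obtain ⟨hN, hiso⟩ := h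
  exact ⟨hN, hiso.congr (Setoid.symm (Quotient.mk_out A))⟩

end Isotypic

section IsotypicDecomposition

variable {π : GroupCover.{u, u} G}

/-- The quotient by a coatom is indecomposable. Its kernel is a finite simple module if abelian;
otherwise the quotient itself represents a class in `Λ_na(G)`, which is why `π` lives in the
universe of `G`. -/
theorem exists_mem_isotypicSet {M : Subgroup π.total} (hM : M ∈ π.coatoms) :
    (∃ t, M ∈ π.isotypicSet t) ∧
      ((∃ A : FiniteSimpleModule G, M ∈ π.abSet A) ∨
        ¬ ∀ x ∈ π.ker, ∀ y ∈ π.ker, x * y * x⁻¹ * y⁻¹ ∈ M) := by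
  have hN := isSubKernel_of_mem_coatoms hM
  have hq := π.quotHom_surjective M hN
  have hind : (π.quot M hN).IsIndecomposable := by
    rw [isIndecomposable_iff_mem_coatoms (π.quotHom M hN) hq, kernel_quotHom]
    exact hM
  by_cases hab : (π.quot M hN).HasAbelianKer
  · obtain ⟨A, hA⟩ := exists_kerIso _ hind hab
    exact ⟨⟨_, mem_isotypicSet_of_mem_abSet ⟨hN, hA⟩⟩, Or.inl ⟨A, hN, hA⟩⟩
  · let ζ : NonabelianIndecomposable G := ⟨π.quot M hN, hind, hab⟩
    refine ⟨⟨Sum.inl ⟦ζ⟧, hN, ?_⟩, Or.inr ?_⟩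
    · have h : Quotient.out ⟦ζ⟧ ≈ ζ := Quotient.mk_out ζ
      exact IsoOver.symm h
    · rwa [hasAbelianKer_iff (π.quotHom M hN) hq, kernel_quotHom] at hab

/-- A coatom that contains a finite intersection of the subgroups `N_λ` belongs to one of the
corresponding sets `𝒞_λ`. -/
theorem exists_mem_isotypicSet_of_finset {M : Subgroup π.total} (hM : M ∈ π.coatoms)
    (F : Finset (LambdaNa G ⊕ LambdaAb G))
    (h : π.ker ⊓ (F.inf fun t => π.ker ⊓ sInf (π.isotypicSet t)) ≤ M) :
    ∃ t ∈ F, M ∈ π.isotypicSet t := by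
  classical
  -- Listing all members of the sets `𝒞_t` with `t ∈ F` in one family lets compactness replace the
  -- infinite intersections `N_t` by a finite intersection of coatoms.
  let N : (Σ t : F, π.isotypicSet t) → Subgroup π.total := fun i => i.2
  have hco : ∀ i, N i ∈ π.coatoms := fun i => mem_coatoms_of_mem_isotypicSet i.2.2
  have hN : ∀ i, π.IsSubKernel (N i) := fun i => isSubKernel_of_mem_coatoms (hco i)
  obtain ⟨F', hF'⟩ := exists_finset_of_iInf_le hM N hN fun x hx hxN =>
    h ⟨hx, (mem_finset_inf_iff F _).2 fun t ht =>
      ⟨hx, Subgroup.mem_sInf.2 fun L hL => hxN ⟨⟨t, ht⟩, ⟨L, hL⟩⟩⟩⟩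
  rcases (exists_mem_isotypicSet hM).2 with ⟨A, hA⟩ | hna
  -- In the abelian case `M` need not be one of the listed coatoms; one of them merely has the same
  -- type, and uniqueness of types suffices.
  · obtain ⟨φ, hφ, rfl⟩ := mem_abSet_iff.1 hA
    obtain ⟨i, -, hi⟩ := exists_mem_abSet_of_finset F' N (fun i _ => hco i) φ hφ hF'
    refine ⟨i.1, i.1.2, ?_⟩
    rw [isotypicSet_unique i.2.2 (mem_isotypicSet_of_mem_abSet hi)]
    exact mem_isotypicSet_of_mem_abSet hA
  · obtain ⟨i, -, hi⟩ := exists_le_of_finset_inf_le hM hna F' N (fun i _ => hN i) hF'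
    refine ⟨i.1, i.1.2, ?_⟩
    rw [← eq_of_le_of_mem_coatoms (hco i) hM hi]
    exact i.2.2

/-- The projections to the isotypic parts are jointly surjective, and jointly injective if `π` is
fundamental. -/
theorem exists_isotypic_family (hπ : π.IsFundamental) :
    ∃ ψ : ∀ t, OverHom π (π.isotypicPart t), JointlySurjective ψ ∧ JointlyInjective ψ := by
  have hψ : ∀ t, ∃ p : OverHom π (π.isotypicPart t), Function.Surjective p ∧
      p.kernel = π.ker ⊓ sInf (π.isotypicSet t) := by
    rintro (ζ | A)
    · have hN := π.isSubKernel_inter (π.naSet ζ.rep) fun _ hN => hN.1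
      exact ⟨π.quotHom _ hN, π.quotHom_surjective _ hN, π.kernel_quotHom _ hN⟩
    · have hN := π.isSubKernel_inter (π.abSet A.rep) fun _ hN => hN.1
      exact ⟨π.quotHom _ hN, π.quotHom_surjective _ hN, π.kernel_quotHom _ hN⟩
  choose ψ hsurj hker using hψ
  refine ⟨ψ, jointlySurjective_of_coatoms ψ hsurj fun F j hj M hM hjM hFM => ?_,
    fun x hx h => ?_⟩
  · simp only [hker] at hjM hFM
    -- Containing `N_j` forces `M` to have type `j`, and containing the other intersection forces a
    -- type in `F`; types are unique and `j ∉ F`.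
    obtain ⟨t, ht, htM⟩ := exists_mem_isotypicSet_of_finset hM {j} (by
      rw [Finset.inf_singleton]
      exact inf_le_right.trans hjM)
    obtain ⟨t', ht', htM'⟩ := exists_mem_isotypicSet_of_finset hM F hFM
    rw [Finset.mem_singleton] at ht
    rw [isotypicSet_unique htM' htM, ht] at ht'
    exact hj ht'
  · refine isFundamental_iff.1 hπ x hx fun M hM => ?_
    obtain ⟨⟨t, ht⟩, -⟩ := exists_mem_isotypicSet hM
    have hxt := (ψ t).mem_kernel.2 (h t)
    rw [hker] at hxt
    exact Subgroup.mem_sInf.1 hxt.2 M ht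

end IsotypicDecomposition

/-! ### Regrouping fiber products and bounding index sets -/

/-- Fiber products of fiber products, for two families of covers. -/
theorem isoOver_fiberProduct_sum {π : GroupCover.{u, v₁} G} {Λ Μ : Type w}
    {D : Λ ⊕ Μ → GroupCover.{u, v} G} {I : Λ → Type v₂} {J : Μ → Type v₂}
    (E : ∀ l, I l → GroupCover.{u, v₃} G) (E' : ∀ m, J m → GroupCover.{u, v₃} G)
    (hπ : π.IsoOver (fiberProduct D)) (hE : ∀ l, (D (Sum.inl l)).IsoOver (fiberProduct (E l)))
    (hE' : ∀ m, (D (Sum.inr m)).IsoOver (fiberProduct (E' m))) :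
    π.IsoOver (fiberProduct
      (Sum.elim (fun p : Σ l, I l => E p.1 p.2) (fun p : Σ m, J m => E' p.1 p.2))) := by
  obtain ⟨ψ, hψs, hψi⟩ := hπ.exists_family
  choose ξ hξs hξi using fun l => (hE l).exists_family
  choose χ hχs hχi using fun m => (hE' m).exists_family
  refine isoOver_fiberProduct
    (fun | Sum.inl p => (ξ p.1 p.2).comp (ψ _) | Sum.inr p => (χ p.1 p.2).comp (ψ _))
    (fun g y hy => ?_) fun x hx h => ?_
  · choose a ha hai using fun l => hξs l g
      (fun i => y (Sum.inl ⟨l, i⟩)) fun i => hy (Sum.inl ⟨l, i⟩)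
    choose b hb hbi using fun m => hχs m g
      (fun j => y (Sum.inr ⟨m, j⟩)) fun j => hy (Sum.inr ⟨m, j⟩)
    obtain ⟨x, hx, hxi⟩ := hψs g (fun | Sum.inl l => a l | Sum.inr m => b m)
      (fun | Sum.inl l => ha l | Sum.inr m => hb m)
    refine ⟨x, hx, ?_⟩
    rintro (⟨l, i⟩ | ⟨m, j⟩)
    · exact (congrArg (ξ l i) (hxi (Sum.inl l))).trans (hai l i)
    · exact (congrArg (χ m j) (hxi (Sum.inr m))).trans (hbi m j)
  · refine hψi x hx ?_
    rintro (l | m)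
    · exact hξi l _ ((ψ _).mem_ker_iff.2 hx) fun i => h (Sum.inl ⟨l, i⟩)
    · exact hχi m _ ((ψ _).mem_ker_iff.2 hx) fun j => h (Sum.inr ⟨m, j⟩)

/-- A fiber product of indecomposable covers that is isomorphic to a cover in the universe `v` may
be indexed by a type in the universe `v`. -/
theorem exists_small_index {π : GroupCover.{u, v} G} {K : Type w} {E : K → GroupCover.{u, v} G}
    (hE : ∀ k, (E k).IsIndecomposable) (h : π.IsoOver (fiberProduct E)) :
    ∃ (I : Type v) (E' : I → GroupCover.{u, v} G), (∀ i, (E' i).IsIndecomposable) ∧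
      π.IsoOver (fiberProduct E') := by
  obtain ⟨ψ, hs, hi⟩ := h.exists_family
  -- The index set embeds into the subgroups of `π.total` by taking kernels.
  have : Small.{v} K := small_of_injective (hs.injective_kernel hE)
  refine ⟨Shrink.{v} K, fun i => E ((equivShrink K).symm i), fun i => hE _,
    isoOver_fiberProduct (fun i => ψ ((equivShrink K).symm i))
      (hs.comp_injective (equivShrink K).symm.injective) fun x hx h => hi x hx fun k => ?_⟩
  obtain ⟨i, rfl⟩ := (equivShrink K).symm.surjective k
  exact h i

/-- A fundamental cover is the fiber product of its non-abelian and its abelian part. -/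
theorem isoOver_naPart_abPart {π : GroupCover.{u, u} G} (hπ : π.IsFundamental) :
    π.IsoOver (fiberProduct fun b : Bool =>
      if b then fiberProduct fun ζ : LambdaNa G => π.naPart ζ.rep
      else fiberProduct fun A : LambdaAb G => π.abPart A.rep) := by
  obtain ⟨ψ, hs, hi⟩ := exists_isotypic_family hπ
  let ξ : ∀ ζ : LambdaNa G, OverHom π (π.naPart ζ.rep) := fun ζ => ψ (Sum.inl ζ)
  let χ : ∀ A : LambdaAb G, OverHom π (π.abPart A.rep) := fun A => ψ (Sum.inr A)
  refine isoOver_fiberProduct_bool (fiberLift ξ) (fiberLift χ) (fun x y hxy => ?_)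
    fun z hz hz' => ?_
  · obtain ⟨z, hz, hzi⟩ := hs _ (fun | Sum.inl ζ => proj _ ζ x | Sum.inr A => proj _ A y)
      (fun | Sum.inl ζ => (proj _ ζ).comm x | Sum.inr A => ((proj _ A).comm y).trans hxy.symm)
    exact ⟨z, fiberProduct_ext hz fun ζ => hzi (Sum.inl ζ),
      fiberProduct_ext (hz.trans hxy) fun A => hzi (Sum.inr A)⟩
  · refine hi z ((fiberLift ξ).kernel_le hz) ?_
    rintro (ζ | A)
    · exact (congrArg (proj _ ζ) hz).trans (OverHom.map_one _)
    · exact (congrArg (proj _ A) hz').trans (OverHom.map_one _)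

/-- Every basis of `B_A^*` comes with extensions of the corresponding classes. -/
theorem exists_isExtensionOfClass (π : GroupCover.{u, v} G) (A : FiniteSimpleModule G)
    {I : Type w} (φ : Module.Basis I A.endRing (π.dualB A)) :
    ∃ E : I → GroupCover.{u, v} G, ∀ i, (E i).IsExtensionOfClass A (π.S A (φ i)) := by
  have := A.isField_endRing.nontrivial
  exact ⟨_, fun i => isExtensionOfClass_quot (φ i) (φ.ne_zero i)⟩

theorem exists_basis_dualB (π : GroupCover.{u, v} G) (A : FiniteSimpleModule G) :
    ∃ I : Type max u v, Nonempty (Module.Basis I A.endRing (π.dualB A)) := by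
  let _ := A.isField_endRing.toField
  exact ⟨_, ⟨Module.Free.chooseBasis A.endRing (π.dualB A)⟩⟩

end GroupCover

/-! ### Assembly of the theorem -/

theorem mainTheorem4 (G : ProfiniteGrp.{u}) :
    (∀ π : GroupCover.{u, u} G, π.IsFundamental →
      -- `H` is the fiber product of its isotypic parts
      π.IsoOver (GroupCover.fiberProduct π.isotypicPart) ∧
      π.IsoOver (GroupCover.fiberProduct fun b : Bool =>
        if b then GroupCover.fiberProduct fun ζ : LambdaNa G => π.naPart ζ.rep
        else GroupCover.fiberProduct fun A : LambdaAb G => π.abPart A.rep) ∧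
      -- (a) the `ζ`-isotypic parts
      (∀ ζ : GroupCover.{u, u} G, ζ.IsIndecomposable → ¬ ζ.HasAbelianKer →
        ∀ (I : Type u) (E : I → GroupCover.{u, u} G), Nonempty (I ≃ π.naSet ζ) →
          (∀ i, (E i).IsoOver ζ) → (π.naPart ζ).IsoOver (GroupCover.fiberProduct E)) ∧
      -- (b) the `A`-isotypic parts
      (∀ (A : FiniteSimpleModule G) (I : Type u)
        (φ : Module.Basis I A.endRing (π.dualB A)),
        (∃ E : I → GroupCover.{u, u} G, ∀ i, (E i).IsExtensionOfClass A (π.S A (φ i))) ∧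
        ∀ E : I → GroupCover.{u, u} G, (∀ i, (E i).IsExtensionOfClass A (π.S A (φ i))) →
          (π.abPart A).IsoOver (GroupCover.fiberProduct E)) ∧
      -- `H` is the fiber product of all these indecomposable covers
      (∀ (I : LambdaNa G → Type u) (E : ∀ ζ, I ζ → GroupCover.{u, u} G)
        (J : LambdaAb G → Type u)
        (φ : ∀ A, Module.Basis (J A) A.rep.endRing (π.dualB A.rep))
        (E' : ∀ A, J A → GroupCover.{u, u} G),
        (∀ ζ, Nonempty (I ζ ≃ π.naSet ζ.rep)) →
        (∀ ζ i, (E ζ i).IsoOver ζ.rep) →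
        (∀ A j, (E' A j).IsExtensionOfClass A.rep (π.S A.rep (φ A j))) →
          (∀ ζ i, (E ζ i).IsIndecomposable) ∧
          (∀ A j, (E' A j).IsIndecomposable) ∧
          π.IsoOver (GroupCover.fiberProduct
            (Sum.elim (fun p : Σ ζ, I ζ => E p.1 p.2) (fun p : Σ A, J A => E' p.1 p.2))))) ∧
    -- a cover is fundamental if and only if it is a fiber product of indecomposable covers
    (∀ π : GroupCover.{u, u} G, π.IsFundamental ↔
      ∃ (I : Type u) (E : I → GroupCover.{u, u} G), (∀ i, (E i).IsIndecomposable) ∧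
        π.IsoOver (GroupCover.fiberProduct E)) ∧
    (∀ (I : Type w) (E : I → GroupCover.{u, v} G), (∀ i, (E i).IsIndecomposable) →
      (GroupCover.fiberProduct E).IsFundamental) := by
  have hdec : ∀ π : GroupCover.{u, u} G, π.IsFundamental →
      π.IsoOver (GroupCover.fiberProduct π.isotypicPart) := fun π hπ => by
    obtain ⟨ψ, hs, hi⟩ := GroupCover.exists_isotypic_family hπ
    exact GroupCover.isoOver_fiberProduct ψ hs hi
  -- Isolated because it also supplies the forward direction of the characterization of fundamental
  -- covers.
  have hfull : ∀ π : GroupCover.{u, u} G, π.IsFundamental →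
      ∀ (I : LambdaNa G → Type u) (E : ∀ ζ, I ζ → GroupCover.{u, u} G)
        (J : LambdaAb G → Type u)
        (φ : ∀ A, Module.Basis (J A) A.rep.endRing (π.dualB A.rep))
        (E' : ∀ A, J A → GroupCover.{u, u} G),
        (∀ ζ, Nonempty (I ζ ≃ π.naSet ζ.rep)) →
        (∀ ζ i, (E ζ i).IsoOver ζ.rep) →
        (∀ A j, (E' A j).IsExtensionOfClass A.rep (π.S A.rep (φ A j))) →
          (∀ ζ i, (E ζ i).IsIndecomposable) ∧
          (∀ A j, (E' A j).IsIndecomposable) ∧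
          π.IsoOver (GroupCover.fiberProduct
            (Sum.elim (fun p : Σ ζ, I ζ => E p.1 p.2) (fun p : Σ A, J A => E' p.1 p.2))) := by
    intro π hπ I E J φ E' hI hE hE'
    refine ⟨fun ζ i => (hE ζ i).isIndecomposable (GroupCover.rep_isIndecomposable ζ),
      fun A j => (hE' A j).kerIso.isIndecomposable,
      GroupCover.isoOver_fiberProduct_sum E E' (hdec π hπ) (fun ζ => ?_) fun A => ?_⟩
    · exact GroupCover.naPart_isoOver_fiberProduct (GroupCover.rep_isIndecomposable ζ)
        (GroupCover.not_hasAbelianKer_rep ζ) (E ζ) (hI ζ).some (hE ζ)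
    · exact GroupCover.isoOver_fiberProduct_of_basis (GroupCover.abPart_separated π A.rep) (φ A)
        (E' A) (hE' A)
  refine ⟨fun π hπ => ⟨hdec π hπ, GroupCover.isoOver_naPart_abPart hπ, ?_, ?_, hfull π hπ⟩,
    fun π => ⟨fun hπ => ?_, ?_⟩, ?_⟩
  · intro ζ hζ hna I E ⟨e⟩ hE
    exact GroupCover.naPart_isoOver_fiberProduct hζ hna E e hE
  · intro A I φ
    exact ⟨π.exists_isExtensionOfClass A φ, fun E hE =>
      GroupCover.isoOver_fiberProduct_of_basis (π.abPart_separated A) φ E hE⟩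
  · choose J φ using fun A : LambdaAb G => π.exists_basis_dualB A.rep
    choose E' hE' using fun A => π.exists_isExtensionOfClass A.rep (φ A).some
    -- The simplest admissible data: `𝒞_ζ` as its own index set with constant family `ζ`, and chosen
    -- bases of the spaces `B_A^*`.
    obtain ⟨h1, h2, h3⟩ := hfull π hπ (fun ζ => π.naSet ζ.rep) (fun ζ _ => ζ.rep) J
      (fun A => (φ A).some) E' (fun ζ => ⟨Equiv.refl _⟩)
      (fun ζ _ => ⟨ContinuousMulEquiv.refl _, fun _ => rfl⟩) hE'
    -- The disjoint union is indexed over `Λ(G)`, which lives one universe higher, so the index set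
    -- has to be shrunk.
    refine GroupCover.exists_small_index ?_ h3
    rintro (p | p)
    · exact h1 p.1 p.2
    · exact h2 p.1 p.2
  · rintro ⟨I, E, hE, hiso⟩
    obtain ⟨ψ, hs, hi⟩ := hiso.exists_family
    exact GroupCover.isFundamental_of_jointlyInjective ψ hs.surjective hi hE
  · intro I E hE
    exact GroupCover.isFundamental_of_jointlyInjective (GroupCover.proj E)
      (GroupCover.jointlySurjective_proj E).surjective (GroupCover.jointlyInjective_proj E) hE
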